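/- Let $H$ be a finite loopless multigraph of constant multiplicity, that is, for some integer $m\ge 1$ any two adjacent vertices of $H$ are joined by exactly $m$ parallel edges. Let $G$ be the line graph of $H$: the simple graph whose vertices are the edges of $H$, two distinct edges being adjacent if and only if they have a common end. Let $t=\chi(G)$ be the chromatic number of $G$. Then $G$ contains a totally odd strong immersion of the complete graph $K_t$. That is, there are an injective map $\varphi\colon V(K_t)\to V(G)$ and, for every edge $uv$ of $K_t$, a path $P_{uv}$ in $G$ with ends $\varphi(u)$ and $\varphi(v)$ such that 1. the paths $P_{uv}$, for $uv\in E(K_t)$, are pairwise edge-disjoint; 2. no terminal, that is, no vertex of $\varphi(V(K_t))$, is an interior vertex of any path $P_{uv}$; 3. every path $P_{uv}$ has odd length (number of edges). -/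

import Mathlib

/-- The line graph of a multigraph `H`, as a simple graph: its vertices are the edges of `H`, and
two distinct edges are adjacent if and only if they have a common end. -/
def Graph.lineGraph {α β : Type*} (H : Graph α β) : SimpleGraph H.edgeSet where
  Adj e f := e ≠ f ∧ ∃ x, H.Inc e x ∧ H.Inc f x
  symm := ⟨fun _ _ h => ⟨h.1.symm, h.2.imp fun _ hx => ⟨hx.2, hx.1⟩⟩⟩
  loopless := ⟨fun _ h => h.1 rfl⟩

/-- A multigraph has constant multiplicity if, for some natural number `m`, any two adjacent
vertices are joined by exactly `m` parallel edges. -/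
def Graph.HasConstantMultiplicity {α β : Type*} (H : Graph α β) : Prop :=
  ∃ m : ℕ, ∀ x y, H.Adj x y → {e | H.IsLink e x y}.encard = m

/-- An immersion of the graph `K` in the graph `G`. The path of the edge `uv` is given in both
directions, from `φ u` to `φ v` and, reversed, from `φ v` to `φ u`. -/
structure GraphImmersion {W V : Type*} (K : SimpleGraph W) (G : SimpleGraph V) where
  /-- The injection of the vertices of `K` to the terminals. -/
  φ : W → V
  injective : Function.Injective φ
  /-- The path of `G` that represents the edge `uv` of `K`. -/
  path : ∀ {u v : W}, K.Adj u v → G.Walk (φ u) (φ v)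
  isPath : ∀ {u v : W} (h : K.Adj u v), (path h).IsPath
  path_symm : ∀ {u v : W} (h : K.Adj u v), path h.symm = (path h).reverse
  /-- The paths of different edges of `K` have no edge in common. -/
  edgeDisjoint : ∀ {u v u' v' : W} (h : K.Adj u v) (h' : K.Adj u' v'),
    s(u, v) ≠ s(u', v') → List.Disjoint (path h).edges (path h').edges

/-- An immersion is strong if no terminal is an interior vertex of one of its paths: a terminal
on a path is an end of that path. -/
def GraphImmersion.IsStrong {W V : Type*} {K : SimpleGraph W} {G : SimpleGraph V}
    (I : GraphImmersion K G) : Prop :=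
  ∀ {u v : W} (h : K.Adj u v), ∀ x ∈ (I.path h).support,
    x ∈ Set.range I.φ → x = I.φ u ∨ x = I.φ v

/-- An immersion is totally odd if all of its paths have odd length. -/
def GraphImmersion.IsTotallyOdd {W V : Type*} {K : SimpleGraph W} {G : SimpleGraph V}
    (I : GraphImmersion K G) : Prop :=
  ∀ {u v : W} (h : K.Adj u v), Odd (I.path h).length

/-! Merging parallel edges turns `H` into a finite simple graph `G`, and the line graph of `H` is
the lexicographic product of L(G) with a complete graph on `m` vertices (`Graph.exists_iso_blowup`).
An odd path lifts to an odd zigzag between any two layers, so an odd immersion of K_s in L(G) gives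
one of K_{sm} in the product (`OddClique.blowup`), while `s` colours for L(G) give `sm` colours for
the product. It therefore suffices to find one `s` for which L(G) is `s`-colourable and has a
totally odd strong immersion of K_s (`exists_colorable_oddClique`).

Let Δ be the maximum degree of `G`. If Δ colours suffice for the edges, the star at a vertex of
degree Δ is the required clique. Otherwise Δ + 1 colours suffice by Vizing's theorem, and `G`
contains an edge-critical subgraph for r = Δ, in which K_{r+1} is to be immersed
(`Critical.oddClique`). By Vizing's adjacency lemma every non-isolated vertex of it has two
neighbours of degree `r`; with an uncrossing of minimum cuts this yields vertices `x`, `a` of degree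
`r` that no cut of fewer than `r` edges separates. Menger's theorem gives `r` edge-disjoint paths
from `x` to `a`.

The terminals are the `r` edges at `x` and the last edge `h` of one path P_j (`oddClique_of_paths`).
The edges at `x` are pairwise adjacent; each is joined to `h` along its own path, and a wrong parity
is repaired by a detour through a third edge at the second vertex of the path. For r ≥ 3 at most one
second vertex has degree below three, and the choice of `j` settles the parity there. For r = 2 the
paths are an edge and an even Kempe chain. -/

open scoped Classical in
/-- Three vertices of degree at most one cannot lie in the same component of a graph of maximum
degree at most two. -/
theorem SimpleGraph.not_reachable_of_three_ends {V : Type*} [Fintype V] (K : SimpleGraph V)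
    (hK : ∀ v, K.degree v ≤ 2) {x u v : V} (hxu : x ≠ u) (hxv : x ≠ v) (huv : u ≠ v)
    (hx : K.degree x ≤ 1) (hu : K.degree u ≤ 1) (hv : K.degree v ≤ 1)
    (hru : K.Reachable x u) (hrv : K.Reachable x v) : False := by
  set C := K.connectedComponentMk x with hC
  have hxC : x ∈ C := rfl
  have huC : u ∈ C := SimpleGraph.ConnectedComponent.sound hru.symm
  have hvC : v ∈ C := SimpleGraph.ConnectedComponent.sound hrv.symm
  have h1 := C.connected_toSimpleGraph.card_vert_le_card_edgeSet_add_one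
  have h2 := C.toSimpleGraph.sum_degrees_eq_twice_card_edges
  have hdeg : ∀ w : C, C.toSimpleGraph.degree w ≤ K.degree w := fun w => by
    rw [← SimpleGraph.card_neighborFinset_eq_degree, ← SimpleGraph.card_neighborFinset_eq_degree]
    refine Finset.card_le_card_of_injOn (fun z => (z : V)) ?_ (by
      intro a _ b _ hab; exact Subtype.ext hab)
    intro z hz
    have hz' : C.toSimpleGraph.Adj w z := by simpa using hz
    have : K.Adj w z := hz'
    simpa using this
  -- A component with n vertices has at least n - 1 edges, so degree sum at least 2n - 2; the three
  -- ends would push it down to 2n - 3.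
  have hsum : ∑ w : C, (C.toSimpleGraph.degree w +
      (if w = ⟨x, hxC⟩ then 1 else 0) + (if w = ⟨u, huC⟩ then 1 else 0) +
      (if w = ⟨v, hvC⟩ then 1 else 0)) ≤ ∑ w : C, 2 := by
    refine Finset.sum_le_sum fun w _ => ?_
    have hw := hdeg w
    have hw2 := hK w
    by_cases a : w = ⟨x, hxC⟩
    · subst a
      simp [hxu, hxv] at hw ⊢
      omega
    by_cases b : w = ⟨u, huC⟩
    · subst b
      simp [huv, hxu.symm] at hw ⊢
      omega
    by_cases d : w = ⟨v, hvC⟩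
    · subst d
      simp [huv.symm, hxv.symm] at hw ⊢
      omega
    simp [a, b, d]
    omega
  simp only [Finset.sum_add_distrib, h2, Finset.sum_ite_eq', Finset.mem_univ, if_true,
    Finset.sum_const, Finset.card_univ, smul_eq_mul] at hsum
  rw [Nat.card_eq_fintype_card, Nat.card_eq_fintype_card] at h1
  rw [← SimpleGraph.edgeFinset_card] at h1
  omega

/-! ### Vizing fans and Kempe chains. -/

namespace EdgeColoring

variable {V C : Type*}

/-- A map on unordered pairs is a proper edge-colouring of `K` if edges of `K` with a common end
receive distinct colours. -/
def IsProper (K : SimpleGraph V) (c : Sym2 V → C) : Prop :=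
  ∀ ⦃v u w⦄, K.Adj v u → K.Adj v w → u ≠ w → c s(v, u) ≠ c s(v, w)

/-- The colour `a` does not occur on the edges of `K` at `v`. -/
def Misses (K : SimpleGraph V) (c : Sym2 V → C) (v : V) (a : C) : Prop :=
  ∀ ⦃w⦄, K.Adj v w → c s(v, w) ≠ a

/-- The vertices that are reached from `y` by a fan at `x` with a given number of steps. -/
inductive FanReach (K : SimpleGraph V) (c : Sym2 V → C) (x y : V) : ℕ → V → Prop
  | base : FanReach K c x y 0 y
  | step {n : ℕ} {u w : V} : FanReach K c x y n u → K.Adj x w → Misses K c u (c s(x, w)) →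
      FanReach K c x y (n + 1) w

open scoped Classical in
theorem IsProper.update {K : SimpleGraph V} {c : Sym2 V → C} (hc : IsProper K c) {x v : V} {a : C}
    (hx : Misses K c x a) (hv : Misses K c v a) :
    IsProper K (Function.update c s(x, v) a) := by
  intro p q r hq hr hqr
  by_cases h1 : s(p, q) = s(x, v)
  · have h2 : s(p, r) ≠ s(x, v) := by
      rw [← h1]
      intro h
      exact hqr ((Sym2.congr_right.mp h).symm)
    rw [h1, Function.update_self, Function.update_of_ne h2]
    rcases Sym2.eq_iff.mp h1 with ⟨rfl, rfl⟩ | ⟨rfl, rfl⟩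
    · exact (hx hr).symm
    · exact (hv hr).symm
  · by_cases h2 : s(p, r) = s(x, v)
    · rw [h2, Function.update_self, Function.update_of_ne h1]
      rcases Sym2.eq_iff.mp h2 with ⟨rfl, rfl⟩ | ⟨rfl, rfl⟩
      · exact hx hq
      · exact hv hq
    · rw [Function.update_of_ne h1, Function.update_of_ne h2]
      exact hc hq hr hqr

-- Recolouring the edge `xv` changes colours only at `x` and `v`, so a fan that has not met `v`
-- survives it.
open scoped Classical in
theorem FanReach.update {K : SimpleGraph V} {c : Sym2 V → C} {x y v : V} (a : C) {n : ℕ} {u : V}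
    (h : FanReach K c x y n u) :
    (∃ k ≤ n, FanReach K c x y k v) ∨ FanReach K (Function.update c s(x, v) a) x y n u := by
  induction h with
  | base => exact Or.inr .base
  | @step n u w hu hw hm ih =>
    rcases ih with ⟨k, hk, hkv⟩ | ih
    · exact Or.inl ⟨k, by omega, hkv⟩
    by_cases hwv : w = v
    · subst hwv
      exact Or.inl ⟨n + 1, le_rfl, .step hu hw hm⟩
    by_cases huv : u = v
    · subst huv
      exact Or.inl ⟨n, by omega, hu⟩
    have hux : u ≠ x := by
      rintro rfl
      exact hm hw rfl
    have hne : s(x, w) ≠ s(x, v) := fun h => hwv (Sym2.congr_right.mp h)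
    refine Or.inr (.step ih hw ?_)
    rw [Function.update_of_ne hne]
    intro z hz
    rw [Function.update_of_ne]
    · exact hm hz
    · intro h
      rcases Sym2.eq_iff.mp h with ⟨rfl, _⟩ | ⟨rfl, _⟩
      · exact hux rfl
      · exact huv rfl

/-- In a fan at `x` no vertex misses a colour that `x` misses, if the fan cannot be used to extend
the colouring. -/
theorem FanReach.not_misses {K : SimpleGraph V} {x y : V}
    (hN : ∀ c : Sym2 V → C, IsProper K c → ∀ a, Misses K c x a → ¬ Misses K c y a)
    {n : ℕ} : ∀ {c : Sym2 V → C} {v : V} {a : C}, IsProper K c → FanReach K c x y n v →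
      Misses K c x a → ¬ Misses K c v a := by
  classical
  induction n using Nat.strong_induction_on with
  | _ n ih =>
  intro c v a hc hr hx hv
  cases hr with
  | base => exact hN c hc a hx hv
  | @step n u _ hu hw hm =>
    -- One step of the fan rotation: once `xv` has colour `a`, its old colour is free at `x` and
    -- still free at the predecessor `u`, which ends a shorter fan.
    rcases hu.update (v := v) a with ⟨k, hk, hkv⟩ | h
    · exact ih k (by omega) hc hkv hx hv
    · have hux : u ≠ x := by
        rintro rfl
        exact hm hw rfl
      have huv : u ≠ v := by
        rintro rfl
        exact hm hw.symm (by rw [Sym2.eq_swap])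
      refine ih n (by omega) (hc.update hx hv) h (a := c s(x, v)) ?_ ?_
      · intro z hz
        by_cases hzv : z = v
        · subst hzv
          rw [Function.update_self]
          exact (hx hw).symm
        · rw [Function.update_of_ne fun h => hzv (Sym2.congr_right.mp h)]
          exact hc hz hw hzv
      · intro z hz
        rw [Function.update_of_ne]
        · exact hm hz
        · intro h
          rcases Sym2.eq_iff.mp h with ⟨rfl, _⟩ | ⟨rfl, _⟩
          · exact hux rfl
          · exact huv rfl

/-- The subgraph of the edges of two colours. -/
def kempe (K : SimpleGraph V) (c : Sym2 V → C) (a b : C) : SimpleGraph V where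
  Adj u v := K.Adj u v ∧ (c s(u, v) = a ∨ c s(u, v) = b)
  symm := ⟨fun u v h => ⟨h.1.symm, by rw [Sym2.eq_swap]; exact h.2⟩⟩
  loopless := ⟨fun v h => K.loopless.irrefl v h.1⟩

open scoped Classical in
/-- The colouring obtained by exchanging two colours on the Kempe component of `z`. -/
noncomputable def kempeSwap (K : SimpleGraph V) (c : Sym2 V → C) (a b : C) (z : V) : Sym2 V → C :=
  fun e => if ∃ p ∈ e, (kempe K c a b).Reachable z p then Equiv.swap a b (c e) else c e

open scoped Classical in
theorem kempeSwap_apply {K : SimpleGraph V} {c : Sym2 V → C} {a b : C} {z u v : V}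
    (h : K.Adj u v) : kempeSwap K c a b z s(u, v) =
      if (kempe K c a b).Reachable z u then Equiv.swap a b (c s(u, v)) else c s(u, v) := by
  unfold kempeSwap
  by_cases hu : (kempe K c a b).Reachable z u
  · rw [if_pos ⟨u, by simp, hu⟩, if_pos hu]
  rw [if_neg hu]
  split_ifs with hex
  · obtain ⟨p, hp, hr⟩ := hex
    rcases Sym2.mem_iff.mp hp with rfl | rfl
    · exact absurd hr hu
    · by_cases hcol : c s(u, p) = a ∨ c s(u, p) = b
      · have : (kempe K c a b).Adj u p := ⟨h, hcol⟩
        exact absurd (hr.trans this.symm.reachable) hu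
      · push Not at hcol
        exact Equiv.swap_apply_of_ne_of_ne hcol.1 hcol.2
  · rfl

theorem IsProper.kempeSwap {K : SimpleGraph V} {c : Sym2 V → C} (hc : IsProper K c) (a b : C)
    (z : V) : IsProper K (kempeSwap K c a b z) := by
  classical
  intro v u w hu hw huw
  rw [kempeSwap_apply hu, kempeSwap_apply hw]
  split_ifs with h
  · exact fun h => hc hu hw huw ((Equiv.swap a b).injective h)
  · exact hc hu hw huw

theorem misses_kempeSwap_of_not_reachable {K : SimpleGraph V} {c : Sym2 V → C} {a b d : C}
    {z v : V} (h : ¬ (kempe K c a b).Reachable z v) :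
    Misses K (kempeSwap K c a b z) v d ↔ Misses K c v d := by
  classical
  refine forall_congr' fun w => forall_congr' fun hw => ?_
  rw [kempeSwap_apply hw, if_neg h]

open scoped Classical in
theorem misses_kempeSwap_of_reachable {K : SimpleGraph V} {c : Sym2 V → C} {a b d : C}
    {z v : V} (h : (kempe K c a b).Reachable z v) :
    Misses K (kempeSwap K c a b z) v d ↔ Misses K c v (Equiv.swap a b d) := by
  refine forall_congr' fun w => forall_congr' fun hw => ?_
  rw [kempeSwap_apply hw, if_pos h, Ne, Ne, Equiv.swap_apply_eq_iff]

/-- In a fan at `x`, a vertex that misses `b` is in the same `(a, b)`-component as `x`, where `a`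
is a colour that `x` misses. -/
theorem FanReach.reachable {K : SimpleGraph V} {x y : V}
    (hN : ∀ c : Sym2 V → C, IsProper K c → ∀ a, Misses K c x a → ¬ Misses K c y a)
    {c : Sym2 V → C} {a b : C} (hc : IsProper K c) (hx : Misses K c x a)
    {n : ℕ} : ∀ {v : V}, FanReach K c x y n v → Misses K c v b →
      (kempe K c a b).Reachable v x := by
  classical
  induction n using Nat.strong_induction_on with
  | _ n ih =>
  intro v hr hv
  by_contra hnot
  -- If the component of `v` avoids `x`, exchanging colours on it makes `a` free at both `v` and
  -- `x`. The fan survives: an earlier vertex that misses `b` lies, by induction, in the component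
  -- of `x`, which is not touched, and colours other than `a` and `b` do not move.
  have key : ∀ m ≤ n, ∀ u, FanReach K c x y m u → FanReach K (kempeSwap K c a b v) x y m u := by
    intro m hm u hu
    induction hu with
    | base => exact .base
    | @step m u w hu hw hmiss ih' =>
      refine .step (ih' (by omega)) hw ?_
      rw [kempeSwap_apply hw, if_neg hnot]
      by_cases hb : c s(x, w) = b
      · rw [hb] at hmiss ⊢
        have := ih m (by omega) hu hmiss
        rw [misses_kempeSwap_of_not_reachable]
        · exact hmiss
        · exact fun h => hnot (h.trans this)
      · by_cases h : (kempe K c a b).Reachable v u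
        · rw [misses_kempeSwap_of_reachable h, Equiv.swap_apply_of_ne_of_ne (hx hw) hb]
          exact hmiss
        · rwa [misses_kempeSwap_of_not_reachable h]
  refine (key n le_rfl v hr).not_misses hN (hc.kempeSwap a b v) (a := a) ?_ ?_
  · rwa [misses_kempeSwap_of_not_reachable hnot]
  · rw [misses_kempeSwap_of_reachable (SimpleGraph.Reachable.refl v), Equiv.swap_apply_left a b]
    exact hv

open scoped Classical in
theorem degree_kempe_le_two [Fintype V] {K : SimpleGraph V} {c : Sym2 V → C} (hc : IsProper K c)
    (a b : C) (v : V) : (kempe K c a b).degree v ≤ 2 := by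
  rw [← SimpleGraph.card_neighborFinset_eq_degree]
  refine (Finset.card_le_card_of_injOn (t := {a, b}) (fun w => c s(v, w)) ?_ ?_).trans
    Finset.card_le_two
  · intro w hw
    have : (kempe K c a b).Adj v w := by simpa using hw
    simpa using this.2
  · intro w hw w' hw' h
    have h1 : (kempe K c a b).Adj v w := by simpa using hw
    have h2 : (kempe K c a b).Adj v w' := by simpa using hw'
    by_contra hne
    exact hc h1.1 h2.1 hne h

open scoped Classical in
theorem degree_kempe_le_one [Fintype V] {K : SimpleGraph V} {c : Sym2 V → C} (hc : IsProper K c)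
    {a b : C} {v : V} (h : Misses K c v a ∨ Misses K c v b) : (kempe K c a b).degree v ≤ 1 := by
  rw [← SimpleGraph.card_neighborFinset_eq_degree, Finset.card_le_one]
  intro w hw w' hw'
  have h1 : (kempe K c a b).Adj v w := by simpa using hw
  have h2 : (kempe K c a b).Adj v w' := by simpa using hw'
  by_contra hne
  refine hc h1.1 h2.1 hne ?_
  rcases h with h | h
  · rw [h1.2.resolve_left (h h1.1), h2.2.resolve_left (h h2.1)]
  · rw [h1.2.resolve_right (h h1.1), h2.2.resolve_right (h h2.1)]

/-- Distinct vertices of a fan miss distinct colours. -/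
theorem FanReach.eq_of_misses [Finite V] {K : SimpleGraph V} {x y : V}
    (hN : ∀ c : Sym2 V → C, IsProper K c → ∀ a, Misses K c x a → ¬ Misses K c y a)
    {c : Sym2 V → C} {a b : C} (hc : IsProper K c) (hx : Misses K c x a)
    {n m : ℕ} {u v : V} (hu : FanReach K c x y n u) (hv : FanReach K c x y m v)
    (hub : Misses K c u b) (hvb : Misses K c v b) : u = v := by
  classical
  have := Fintype.ofFinite V
  by_contra huv
  have hxb : ¬ Misses K c x b := fun h => hu.not_misses hN hc h hub
  -- All of `x`, `u`, `v` would be ends of a single `(a, b)`-chain.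
  refine (kempe K c a b).not_reachable_of_three_ends (degree_kempe_le_two hc a b)
    (x := x) (u := u) (v := v) ?_ ?_ huv (degree_kempe_le_one hc (.inl hx))
    (degree_kempe_le_one hc (.inr hub)) (degree_kempe_le_one hc (.inr hvb))
    (hu.reachable hN hc hx hub).symm (hv.reachable hN hc hx hvb).symm
  · rintro rfl; exact hxb hub
  · rintro rfl; exact hxb hvb

end EdgeColoring

/-! ### Critical graphs, Vizing's adjacency lemma and Vizing's theorem. -/

namespace EdgeColoring

variable {V C : Type*}

/-- The edges of `G` have a proper colouring with `r` colours. -/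
def Colorable (G : SimpleGraph V) (r : ℕ) : Prop := ∃ c : Sym2 V → Fin r, IsProper G c

open scoped Classical in
/-- A graph of maximum degree at most `r` whose edges cannot be coloured with `r` colours, although
this is possible once any edge is deleted. -/
structure Critical [Fintype V] (G : SimpleGraph V) (r : ℕ) : Prop where
  pos : 0 < r
  degree_le : ∀ v, G.degree v ≤ r
  not_colorable : ¬ Colorable G r
  colorable_delete : ∀ ⦃u v⦄, G.Adj u v → Colorable (G.deleteEdges {s(u, v)}) r

open scoped Classical in
theorem IsProper.insert {G : SimpleGraph V} {c : Sym2 V → C} {x y : V} {a : C}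
    (hc : IsProper (G.deleteEdges {s(x, y)}) c)
    (hx : Misses (G.deleteEdges {s(x, y)}) c x a) (hy : Misses (G.deleteEdges {s(x, y)}) c y a) :
    IsProper G (Function.update c s(x, y) a) := by
  have hadj : ∀ {p q}, G.Adj p q → s(p, q) ≠ s(x, y) → (G.deleteEdges {s(x, y)}).Adj p q :=
    fun h hne => by simpa [SimpleGraph.deleteEdges_adj] using ⟨h, by simpa using hne⟩
  intro p q r hq hr hqr
  by_cases h1 : s(p, q) = s(x, y)
  · have h2 : s(p, r) ≠ s(x, y) := by
      rw [← h1]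
      intro h
      exact hqr ((Sym2.congr_right.mp h).symm)
    rw [h1, Function.update_self, Function.update_of_ne h2]
    have h3 := hadj hr h2
    rcases Sym2.eq_iff.mp h1 with ⟨rfl, rfl⟩ | ⟨rfl, rfl⟩
    · exact (hx h3).symm
    · exact (hy h3).symm
  · by_cases h2 : s(p, r) = s(x, y)
    · rw [h2, Function.update_self, Function.update_of_ne h1]
      have h3 := hadj hq h1
      rcases Sym2.eq_iff.mp h2 with ⟨rfl, rfl⟩ | ⟨rfl, rfl⟩
      · exact hx h3
      · exact hy h3
    · rw [Function.update_of_ne h1, Function.update_of_ne h2]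
      exact hc (hadj hq h1) (hadj hr h2) hqr

theorem Critical.not_misses_both [Fintype V] {G : SimpleGraph V} {r : ℕ} (hG : Critical G r)
    {x y : V} {c : Sym2 V → Fin r} (hc : IsProper (G.deleteEdges {s(x, y)}) c) {a : Fin r}
    (hx : Misses (G.deleteEdges {s(x, y)}) c x a) :
    ¬ Misses (G.deleteEdges {s(x, y)}) c y a := by
  classical
  exact fun hy => hG.not_colorable ⟨_, hc.insert hx hy⟩

open scoped Classical in
theorem le_card_misses [Fintype V] (K : SimpleGraph V) {r : ℕ} (c : Sym2 V → Fin r) (v : V) :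
    r ≤ K.degree v + (Finset.univ.filter fun a => Misses K c v a).card := by
  have h := Finset.card_filter_add_card_filter_not (s := (Finset.univ : Finset (Fin r)))
    (fun a => Misses K c v a)
  have h2 : (Finset.univ.filter fun a => ¬ Misses K c v a).card ≤ K.degree v := by
    rw [← SimpleGraph.card_neighborFinset_eq_degree]
    refine (Finset.card_le_card ?_).trans
      (Finset.card_image_le (s := K.neighborFinset v) (f := fun w => c s(v, w)))
    intro a ha
    have ha' : ¬ Misses K c v a := by simpa using ha
    unfold Misses at ha'
    push Not at ha'
    obtain ⟨w, hw, rfl⟩ := ha'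
    exact Finset.mem_image.mpr ⟨w, by simpa using hw, rfl⟩
  simp only [Finset.card_univ, Fintype.card_fin] at h
  omega

open scoped Classical in
theorem degree_deleteEdge_add_one [Fintype V] {G K : SimpleGraph V} {x y : V} (h : G.Adj x y)
    (hK : K = G.deleteEdges {s(x, y)}) : K.degree x + 1 = G.degree x := by
  rw [← SimpleGraph.card_neighborFinset_eq_degree, ← SimpleGraph.card_neighborFinset_eq_degree,
    ← Finset.card_erase_add_one (s := G.neighborFinset x) (a := y) (by simpa using h)]
  congr 2
  ext w
  have : s(x, w) = s(x, y) ↔ w = y := Sym2.congr_right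
  simp only [SimpleGraph.mem_neighborFinset, hK, SimpleGraph.deleteEdges_adj, Set.mem_singleton_iff,
    Finset.mem_erase, this]
  tauto

open scoped Classical in
/-- Vizing's adjacency lemma. -/
theorem Critical.adjacency [Fintype V] {G : SimpleGraph V} {r : ℕ} (hG : Critical G r) {x y : V}
    (h : G.Adj x y) : r + 1 ≤ G.degree y +
      ((G.neighborFinset x).filter fun w => w ≠ y ∧ G.degree w = r).card := by
  obtain ⟨c, hc⟩ := hG.colorable_delete h
  obtain ⟨K, hK⟩ : ∃ K, K = G.deleteEdges {s(x, y)} := ⟨_, rfl⟩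
  rw [← hK] at hc
  have hKG : K ≤ G := hK ▸ SimpleGraph.deleteEdges_le _
  have hKxy : ¬ K.Adj x y := by simp [hK]
  have hN : ∀ c : Sym2 V → Fin r, IsProper K c → ∀ a, Misses K c x a → ¬ Misses K c y a :=
    fun c hc a hx => by
      subst hK
      exact hG.not_misses_both hc hx
  have hKdeg : ∀ v, K.degree v ≤ G.degree v := fun v => SimpleGraph.degree_le_of_le hKG
  have hKx : K.degree x + 1 = G.degree x := degree_deleteEdge_add_one h hK
  have hKy : K.degree y + 1 = G.degree y :=
    degree_deleteEdge_add_one h.symm (by rw [hK, Sym2.eq_swap])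
  obtain ⟨a, ha⟩ : ∃ a, Misses K c x a := by
    have h1 := le_card_misses K c x
    have h2 := hG.degree_le x
    obtain ⟨a, ha⟩ := Finset.card_pos.mp
      (show 0 < (Finset.univ.filter fun a => Misses K c x a).card by omega)
    exact ⟨a, by simpa using ha⟩
  set F : Finset V := Finset.univ.filter fun v => ∃ n, FanReach K c x y n v with hF
  have hyF : y ∈ F := by simpa [hF] using ⟨0, FanReach.base⟩
  set M : V → Finset (Fin r) := fun v => Finset.univ.filter fun a => Misses K c v a with hM
  have hdisj : (F : Set V).PairwiseDisjoint M := by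
    intro u hu v hv huv
    rw [Function.onFun, Finset.disjoint_left]
    intro b hbu hbv
    obtain ⟨n, hn⟩ : ∃ n, FanReach K c x y n u := by simpa [hF] using hu
    obtain ⟨m, hm⟩ : ∃ n, FanReach K c x y n v := by simpa [hF] using hv
    exact huv (hn.eq_of_misses hN hc ha hm (by simpa [hM] using hbu) (by simpa [hM] using hbv))
  -- A colour missed in the fan is present at `x`, on an edge whose other end again belongs to the
  -- fan and is not `y`.
  have hcard : (F.biUnion M).card ≤ (F.erase y).card := by
    refine (Finset.card_le_card ?_).trans
      (Finset.card_image_le (s := F.erase y) (f := fun w => c s(x, w)))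
    intro b hb
    obtain ⟨v, hv, hbv⟩ := Finset.mem_biUnion.mp hb
    obtain ⟨n, hn⟩ : ∃ n, FanReach K c x y n v := by simpa [hF] using hv
    have hbv' : Misses K c v b := by simpa [hM] using hbv
    have hxb : ¬ Misses K c x b := fun h => hn.not_misses hN hc h hbv'
    unfold Misses at hxb
    push Not at hxb
    obtain ⟨w, hw, rfl⟩ := hxb
    refine Finset.mem_image.mpr ⟨w, Finset.mem_erase.mpr ⟨?_, ?_⟩, rfl⟩
    · rintro rfl
      exact hKxy hw
    · simpa [hF] using ⟨n + 1, FanReach.step hn hw hbv'⟩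
  rw [Finset.card_biUnion fun u hu v hv huv => hdisj hu hv huv, ← Finset.add_sum_erase F _ hyF]
    at hcard
  -- Each fan vertex of degree below `r` misses a colour, and `y` misses at least `r + 1 - G.degree
  -- y` because `xy` is uncoloured. As the missing sets are disjoint, that many vertices of `F.erase
  -- y` must have degree `r`.
  have hsum : ((F.erase y).filter fun w => ¬ G.degree w = r).card ≤ ∑ v ∈ F.erase y, (M v).card := by
    rw [Finset.card_filter]
    refine Finset.sum_le_sum fun v _ => ?_
    have h1 : r ≤ K.degree v + (M v).card := le_card_misses K c v
    have h2 := hKdeg v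
    have h3 := hG.degree_le v
    split_ifs <;> omega
  have hsplit := Finset.card_filter_add_card_filter_not (s := F.erase y) (fun w => G.degree w = r)
  have hMy : r ≤ K.degree y + (M y).card := le_card_misses K c y
  have hsub : ((F.erase y).filter fun w => G.degree w = r).card ≤
      ((G.neighborFinset x).filter fun w => w ≠ y ∧ G.degree w = r).card := by
    refine Finset.card_le_card fun w hw => ?_
    simp only [Finset.mem_filter, Finset.mem_erase, hF, Finset.mem_univ, true_and] at hw
    obtain ⟨⟨hwy, n, hn⟩, hwr⟩ := hw
    simp only [Finset.mem_filter, SimpleGraph.mem_neighborFinset]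
    refine ⟨?_, hwy, hwr⟩
    cases hn with
    | base => exact absurd rfl hwy
    | step _ hxw _ => exact hKG hxw
  omega

open scoped Classical in
/-- Every vertex of a critical graph that is not isolated has two neighbours of maximum degree. -/
theorem Critical.two_le_card_full [Fintype V] {G : SimpleGraph V} {r : ℕ} (hG : Critical G r)
    {x y : V} (h : G.Adj x y) : 2 ≤ ((G.neighborFinset x).filter fun w => G.degree w = r).card := by
  by_cases hall : ∃ w, G.Adj x w ∧ G.degree w < r
  · obtain ⟨w, hw, hwr⟩ := hall
    have h1 := hG.adjacency hw
    have h2 : ((G.neighborFinset x).filter fun z => z ≠ w ∧ G.degree z = r).card ≤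
        ((G.neighborFinset x).filter fun w => G.degree w = r).card :=
      Finset.card_le_card (Finset.monotone_filter_right _ fun z _ hz => hz.2)
    omega
  · push Not at hall
    have h1 := hG.adjacency h
    have hy : G.degree y = r := le_antisymm (hG.degree_le y) (hall y h)
    have h2 : insert y ((G.neighborFinset x).filter fun w => w ≠ y ∧ G.degree w = r) ⊆
        (G.neighborFinset x).filter fun w => G.degree w = r := by
      intro z hz
      rcases Finset.mem_insert.mp hz with rfl | hz
      · simpa using ⟨h, hy⟩
      · simp only [Finset.mem_filter] at hz ⊢
        exact ⟨hz.1, hz.2.2⟩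
    have h3 := Finset.card_le_card h2
    rw [Finset.card_insert_of_notMem (by simp)] at h3
    omega

open scoped Classical in
/-- If `x` has a neighbour of degree at most two, then its other neighbours have degree `r`, when
the graph is critical. -/
theorem Critical.degree_eq_of_degree_le_two [Fintype V] {G : SimpleGraph V} {r : ℕ}
    (hG : Critical G r) {x y z : V} (hy : G.Adj x y) (hz : G.Adj x z) (hyz : z ≠ y)
    (hd : G.degree y ≤ 2) : G.degree z = r := by
  have h1 := hG.adjacency hy
  have h2 : ((G.neighborFinset x).filter fun w => w ≠ y ∧ G.degree w = r) ⊆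
      (G.neighborFinset x).erase y := by
    intro w hw
    simp only [Finset.mem_filter] at hw
    exact Finset.mem_erase.mpr ⟨hw.2.1, hw.1⟩
  have h3 : ((G.neighborFinset x).erase y).card + 1 = G.degree x := by
    rw [Finset.card_erase_add_one (by simpa using hy), SimpleGraph.card_neighborFinset_eq_degree]
  have h4 := hG.degree_le x
  -- The adjacency lemma gives at least `r - 1` neighbours of degree `r` besides `y`, and `x` has no
  -- more than `r - 1` other neighbours.
  have h5 := Finset.eq_of_subset_of_card_le h2 (by omega)
  have h6 : z ∈ (G.neighborFinset x).erase y := Finset.mem_erase.mpr ⟨hyz, by simpa using hz⟩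
  rw [← h5] at h6
  exact (Finset.mem_filter.mp h6).2.2

open scoped Classical in
theorem Critical.exists_adj [Fintype V] {G : SimpleGraph V} {r : ℕ} (hG : Critical G r) :
    ∃ x y, G.Adj x y := by
  by_contra h
  push Not at h
  exact hG.not_colorable ⟨fun _ => ⟨0, hG.pos⟩, fun v u w hu _ _ => absurd hu (h v u)⟩

open scoped Classical in
/-- A graph of maximum degree at most `r` whose edges cannot be coloured with `r` colours contains
a critical graph. -/
theorem exists_critical_le [Fintype V] {r : ℕ} (hr : 0 < r) {G : SimpleGraph V}
    (hdeg : ∀ v, G.degree v ≤ r) (hG : ¬ Colorable G r) : ∃ K ≤ G, Critical K r := by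
  obtain ⟨K, hK, hmin⟩ := Set.Finite.exists_minimal (s := {K | K ≤ G ∧ ¬ Colorable K r})
    (Set.toFinite _) ⟨G, le_rfl, hG⟩
  refine ⟨K, hK.1, hr, fun v => (SimpleGraph.degree_le_of_le hK.1).trans (hdeg v), hK.2, ?_⟩
  intro u v huv
  by_contra hcol
  have hle : K.deleteEdges {s(u, v)} ≤ K := SimpleGraph.deleteEdges_le _
  have := hmin ⟨hle.trans hK.1, hcol⟩ hle huv
  simp at this

open scoped Classical in
/-- Vizing's theorem. -/
theorem colorable_succ [Fintype V] {r : ℕ} {G : SimpleGraph V} (hdeg : ∀ v, G.degree v ≤ r) :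
    Colorable G (r + 1) := by
  by_contra h
  obtain ⟨K, hK, hcrit⟩ := exists_critical_le (Nat.succ_pos r)
    (fun v => (hdeg v).trans r.le_succ) h
  -- A graph critical for `r + 1` has a vertex of degree `r + 1`, too large for a subgraph of `G`.
  obtain ⟨x, y, hxy⟩ := hcrit.exists_adj
  obtain ⟨w, hw⟩ := Finset.card_pos.mp (zero_lt_two.trans_le (hcrit.two_le_card_full hxy))
  have h1 := (Finset.mem_filter.mp hw).2
  have h2 : K.degree w ≤ G.degree w := SimpleGraph.degree_le_of_le hK
  have := hdeg w
  omega

end EdgeColoring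

/-! ### Unit-capacity integral flows and Menger's theorem. -/

namespace UnitFlow

variable {V : Type*}

open scoped Classical in
/-- The number of edges of `G` that leave `S`. -/
noncomputable def cutCard [Fintype V] (G : SimpleGraph V) (S : Finset V) : ℕ :=
  ((S ×ˢ Sᶜ).filter fun p => G.Adj p.1 p.2).card

open scoped Classical in
/-- The unit flow along a walk. -/
noncomputable def ofWalk {G : SimpleGraph V} : ∀ {u v : V}, G.Walk u v → V → V → ℤ
  | _, _, .nil => fun _ _ => 0
  | u, _, .cons (v := v) _ p => fun s t =>
      (if s = u ∧ t = v then 1 else 0) - (if s = v ∧ t = u then 1 else 0) + ofWalk p s t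

open scoped Classical in
theorem ofWalk_antisymm {G : SimpleGraph V} {u v : V} (p : G.Walk u v) (s t : V) :
    ofWalk p s t = - ofWalk p t s := by
  induction p with
  | nil => simp [ofWalk]
  | @cons u v w h p ih =>
    simp only [ofWalk, ih]
    rw [if_congr (and_comm : t = v ∧ s = u ↔ s = u ∧ t = v) rfl rfl,
      if_congr (and_comm : t = u ∧ s = v ↔ s = v ∧ t = u) rfl rfl]
    ring

open scoped Classical in
theorem sum_ofWalk [Fintype V] {G : SimpleGraph V} {u v : V} (p : G.Walk u v) (s : V) :
    ∑ t, ofWalk p s t = (if s = u then 1 else 0) - (if s = v then 1 else 0) := by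
  induction p with
  | nil => simp [ofWalk]
  | cons h p ih =>
    simp only [ofWalk, Finset.sum_add_distrib, Finset.sum_sub_distrib, ih, ite_and]
    split_ifs <;> simp

theorem ofWalk_eq_zero {G : SimpleGraph V} {u v : V} (p : G.Walk u v) {s t : V}
    (h : s ∉ p.support ∨ t ∉ p.support) : ofWalk p s t = 0 := by
  induction p with
  | nil => simp [ofWalk]
  | @cons u v w hadj p ih =>
    have hv : v ∈ p.support := p.start_mem_support
    simp only [SimpleGraph.Walk.support_cons, List.mem_cons, not_or] at h
    have h1 : ¬ (s = u ∧ t = v) := by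
      rintro ⟨rfl, rfl⟩
      rcases h with h | h
      · exact h.1 rfl
      · exact h.2 hv
    have h2 : ¬ (s = v ∧ t = u) := by
      rintro ⟨rfl, rfl⟩
      rcases h with h | h
      · exact h.2 hv
      · exact h.1 rfl
    simp [ofWalk, h1, h2, ih (h.imp And.right And.right)]

theorem ofWalk_eq_one_of_mem {G : SimpleGraph V} {u v : V} {p : G.Walk u v} (hp : p.IsPath)
    {d : G.Dart} (hd : d ∈ p.darts) : ofWalk p d.fst d.snd = 1 := by
  induction p with
  | nil => simp at hd
  | @cons u v w hadj p ih =>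
    rw [SimpleGraph.Walk.cons_isPath_iff] at hp
    rw [SimpleGraph.Walk.darts_cons, List.mem_cons] at hd
    rcases hd with rfl | hd
    · have h0 : ofWalk p u v = 0 := ofWalk_eq_zero p (.inl hp.2)
      have h1 : u ≠ v := hadj.ne
      simp [ofWalk, h0, h1]
    · have h1 : d.fst ≠ u := by
        rintro rfl
        exact hp.2 (p.dart_fst_mem_support_of_mem_darts hd)
      have h2 : d.snd ≠ u := by
        rintro h
        exact hp.2 (h ▸ p.dart_snd_mem_support_of_mem_darts hd)
      simp [ofWalk, h1, h2, ih hp.1 hd]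

theorem ofWalk_cases {G : SimpleGraph V} {u v : V} {p : G.Walk u v} (hp : p.IsPath) (s t : V) :
    ofWalk p s t = 0 ∨ (ofWalk p s t = 1 ∧ ∃ d ∈ p.darts, d.fst = s ∧ d.snd = t) ∨
      (ofWalk p s t = -1 ∧ ∃ d ∈ p.darts, d.fst = t ∧ d.snd = s) := by
  induction p with
  | nil => simp [ofWalk]
  | @cons u v w hadj p ih =>
    rw [SimpleGraph.Walk.cons_isPath_iff] at hp
    have huv : u ≠ v := hadj.ne
    by_cases h : s = u ∨ t = u
    · have h0 : ofWalk p s t = 0 := ofWalk_eq_zero p <| by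
        rcases h with rfl | rfl
        · exact .inl hp.2
        · exact .inr hp.2
      by_cases h1 : s = u ∧ t = v
      · obtain ⟨rfl, rfl⟩ := h1
        refine .inr (.inl ⟨by simp [ofWalk, h0, huv], ⟨(s, t), hadj⟩, by simp, rfl, rfl⟩)
      · by_cases h2 : s = v ∧ t = u
        · obtain ⟨rfl, rfl⟩ := h2
          refine .inr (.inr ⟨by simp [ofWalk, h0, huv.symm], ⟨(t, s), hadj⟩, by simp, rfl, rfl⟩)
        · exact .inl (by simp [ofWalk, h0, h1, h2])
    · push Not at h
      have he : ofWalk (SimpleGraph.Walk.cons hadj p) s t = ofWalk p s t := by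
        simp [ofWalk, h.1, h.2]
      rw [he]
      refine (ih hp.1).imp id (Or.imp ?_ ?_)
      · rintro ⟨h1, d, hd, h2⟩
        exact ⟨h1, d, by simp [hd], h2⟩
      · rintro ⟨h1, d, hd, h2⟩
        exact ⟨h1, d, by simp [hd], h2⟩

/-- An integral flow from `x` to `a` in which every edge has capacity one. -/
structure IsFlow [Fintype V] (G : SimpleGraph V) (x a : V) (f : V → V → ℤ) : Prop where
  antisymm : ∀ u v, f u v = - f v u
  le_one : ∀ u v, f u v ≤ 1
  eq_zero : ∀ ⦃u v⦄, ¬ G.Adj u v → f u v = 0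
  conserve : ∀ ⦃u⦄, u ≠ x → u ≠ a → ∑ v, f u v = 0

theorem exists_isPath_of_reflTransGen {G : SimpleGraph V} {R : V → V → Prop}
    (hR : ∀ u v, R u v → G.Adj u v) {x a : V} (h : Relation.ReflTransGen R x a) :
    ∃ p : G.Walk x a, p.IsPath ∧ ∀ d ∈ p.darts, R d.fst d.snd := by
  classical
  obtain ⟨p, hp⟩ : ∃ p : G.Walk x a, ∀ d ∈ p.darts, R d.fst d.snd := by
    induction h using Relation.ReflTransGen.head_induction_on with
    | refl => exact ⟨.nil, by simp⟩
    | head h _ ih =>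
      obtain ⟨p, hp⟩ := ih
      refine ⟨.cons (hR _ _ h) p, ?_⟩
      intro d hd
      rw [SimpleGraph.Walk.darts_cons, List.mem_cons] at hd
      rcases hd with rfl | hd
      · exact h
      · exact hp d hd
  exact ⟨p.bypass, p.bypass_isPath, fun d hd => hp d (p.darts_bypass_subset_darts hd)⟩

-- Sum the conservation law over `S`: only `x` contributes, and the flow inside `S` cancels by
-- antisymmetry.
open scoped Classical in
theorem IsFlow.value_eq [Fintype V] {G : SimpleGraph V} {x a : V} {f : V → V → ℤ}
    (hf : IsFlow G x a f) {S : Finset V} (hx : x ∈ S) (ha : a ∉ S) :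
    ∑ v, f x v = ∑ p ∈ S ×ˢ Sᶜ, f p.1 p.2 := by
  have h1 : ∑ u ∈ S, ∑ v, f u v = ∑ v, f x v := by
    refine Finset.sum_eq_single_of_mem x hx fun u hu hux => hf.conserve hux ?_
    rintro rfl
    exact ha hu
  have h2 : ∑ u ∈ S, ∑ v ∈ S, f u v = 0 := by
    have h3 : ∑ u ∈ S, ∑ v ∈ S, f u v = - ∑ u ∈ S, ∑ v ∈ S, f u v := by
      conv_lhs => rw [Finset.sum_comm]
      rw [← Finset.sum_neg_distrib]
      refine Finset.sum_congr rfl fun u _ => ?_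
      rw [← Finset.sum_neg_distrib]
      exact Finset.sum_congr rfl fun v _ => hf.antisymm v u
    omega
  rw [← h1, Finset.sum_product]
  have h4 : ∀ u, ∑ v, f u v = ∑ v ∈ S, f u v + ∑ v ∈ Sᶜ, f u v := fun u =>
    (Finset.sum_add_sum_compl S _).symm
  simp only [h4, Finset.sum_add_distrib, h2, zero_add]

theorem IsFlow.add_ofWalk [Fintype V] {G : SimpleGraph V} {x a : V} {f : V → V → ℤ}
    (hf : IsFlow G x a f) {p : G.Walk x a} (hp : p.IsPath)
    (hpf : ∀ d ∈ p.darts, f d.fst d.snd ≤ 0) : IsFlow G x a fun u v => f u v + ofWalk p u v := by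
  classical
  refine ⟨fun u v => ?_, fun u v => ?_, fun u v huv => ?_, fun u hux hua => ?_⟩
  · rw [hf.antisymm u v, ofWalk_antisymm p u v]
    ring
  · have h1 := hf.le_one u v
    rcases ofWalk_cases hp u v with h | ⟨h, d, hd, rfl, rfl⟩ | ⟨h, _⟩
    · omega
    · have := hpf d hd
      omega
    · omega
  · rcases ofWalk_cases hp u v with h | ⟨_, d, _, rfl, rfl⟩ | ⟨_, d, _, rfl, rfl⟩
    · rw [hf.eq_zero huv, h, add_zero]
    · exact absurd d.adj huv
    · exact absurd d.adj.symm huv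
  · rw [Finset.sum_add_distrib, hf.conserve hux hua, sum_ofWalk]
    simp [hux, hua]

theorem IsFlow.sub_ofWalk [Fintype V] {G : SimpleGraph V} {x a : V} {f : V → V → ℤ}
    (hf : IsFlow G x a f) {p : G.Walk x a} (hp : p.IsPath)
    (hpf : ∀ d ∈ p.darts, f d.fst d.snd = 1) : IsFlow G x a fun u v => f u v - ofWalk p u v := by
  classical
  refine ⟨fun u v => ?_, fun u v => ?_, fun u v huv => ?_, fun u hux hua => ?_⟩
  · rw [hf.antisymm u v, ofWalk_antisymm p u v]
    ring
  · have h1 := hf.le_one u v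
    rcases ofWalk_cases hp u v with h | ⟨h, _⟩ | ⟨h, d, hd, rfl, rfl⟩
    · omega
    · omega
    · have := hpf d hd
      have := hf.antisymm d.fst d.snd
      omega
  · rcases ofWalk_cases hp u v with h | ⟨_, d, _, rfl, rfl⟩ | ⟨_, d, _, rfl, rfl⟩
    · rw [hf.eq_zero huv, h, sub_zero]
    · exact absurd d.adj huv
    · exact absurd d.adj.symm huv
  · rw [Finset.sum_sub_distrib, hf.conserve hux hua, sum_ofWalk]
    simp [hux, hua]

/-- Augmenting paths: if the residual graph does not lead to `a`, the set of vertices it reaches has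
a saturated boundary, so the value is already at least `r`. -/
theorem exists_isFlow [Fintype V] {G : SimpleGraph V} {x a : V} (hxa : x ≠ a) {r : ℕ}
    (hcut : ∀ S : Finset V, x ∈ S → a ∉ S → r ≤ cutCard G S) :
    ∀ k ≤ r, ∃ f, IsFlow G x a f ∧ ∑ v, f x v = k := by
  classical
  intro k
  induction k with
  | zero => exact fun _ => ⟨fun _ _ => 0, ⟨by simp, by simp, by simp, by simp⟩, by simp⟩
  | succ k ih =>
    intro hk
    obtain ⟨f, hf, hval⟩ := ih (by omega)
    set R : V → V → Prop := fun u v => G.Adj u v ∧ f u v ≤ 0 with hR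
    by_cases ha : Relation.ReflTransGen R x a
    · obtain ⟨p, hp, hpR⟩ := exists_isPath_of_reflTransGen (fun u v h => h.1) ha
      refine ⟨_, hf.add_ofWalk hp fun d hd => (hpR d hd).2, ?_⟩
      rw [Finset.sum_add_distrib, hval, sum_ofWalk]
      simp [hxa]
    · exfalso
      set S : Finset V := Finset.univ.filter fun u => Relation.ReflTransGen R x u with hS
      have hxS : x ∈ S := by simpa [hS] using Relation.ReflTransGen.refl
      have haS : a ∉ S := by simpa [hS] using ha
      have h1 := hcut S hxS haS
      have h2 := hf.value_eq hxS haS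
      have h3 : ∑ p ∈ S ×ˢ Sᶜ, f p.1 p.2 = cutCard G S := by
        rw [cutCard, Finset.card_filter, Nat.cast_sum]
        refine Finset.sum_congr rfl fun p hp => ?_
        rw [Finset.mem_product, Finset.mem_compl] at hp
        split_ifs with hadj
        · have h4 : ¬ f p.1 p.2 ≤ 0 := fun hle => hp.2 <| by
            have hp1 : Relation.ReflTransGen R x p.1 := by simpa [hS] using hp.1
            simpa [hS] using hp1.tail ⟨hadj, hle⟩
          have := hf.le_one p.1 p.2
          push_cast
          omega
        · simpa using hf.eq_zero hadj
      omega

/-- Flow decomposition: a flow of positive value contains a path of arcs with flow one, and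
subtracting it lowers the value by one. -/
theorem IsFlow.exists_paths [Fintype V] {G : SimpleGraph V} {x a : V} (hxa : x ≠ a) (k : ℕ) :
    ∀ {f : V → V → ℤ}, IsFlow G x a f → ∑ v, f x v = k →
      ∃ P : Fin k → G.Walk x a, (∀ i, (P i).IsPath) ∧
        (∀ i, ∀ d ∈ (P i).darts, f d.fst d.snd = 1) ∧
        ∀ i j, i ≠ j → (P i).edges.Disjoint (P j).edges := by
  classical
  induction k with
  | zero => exact fun _ _ => ⟨fun i => i.elim0, fun i => i.elim0, fun i => i.elim0, fun i => i.elim0⟩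
  | succ k ih =>
    intro f hf hval
    set R : V → V → Prop := fun u v => f u v = 1 with hR
    have hRadj : ∀ u v, R u v → G.Adj u v := fun u v h => by
      by_contra hn
      have := hf.eq_zero hn
      simp only [hR] at h
      omega
    have ha : Relation.ReflTransGen R x a := by
      by_contra ha
      set S : Finset V := Finset.univ.filter fun u => Relation.ReflTransGen R x u with hS
      have hxS : x ∈ S := by simpa [hS] using Relation.ReflTransGen.refl
      have haS : a ∉ S := by simpa [hS] using ha
      have h2 := hf.value_eq hxS haS
      have h3 : ∑ p ∈ S ×ˢ Sᶜ, f p.1 p.2 ≤ 0 := by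
        refine Finset.sum_nonpos fun p hp => ?_
        rw [Finset.mem_product, Finset.mem_compl] at hp
        have h4 : f p.1 p.2 ≠ 1 := fun h => hp.2 <| by
          have hp1 : Relation.ReflTransGen R x p.1 := by simpa [hS] using hp.1
          simpa [hS] using hp1.tail h
        have := hf.le_one p.1 p.2
        omega
      rw [hval] at h2
      push_cast at h2
      omega
    obtain ⟨p, hp, hpR⟩ := exists_isPath_of_reflTransGen hRadj ha
    have hsub := hf.sub_ofWalk hp hpR
    obtain ⟨P, hP, hPf, hPd⟩ := ih hsub (by
      rw [Finset.sum_sub_distrib, hval, sum_ofWalk]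
      simp [hxa])
    -- Subtraction leaves zero flow on the edges of `p` in either direction, so the later paths
    -- avoid them.
    have hz : ∀ i, ∀ d ∈ (P i).darts, f d.fst d.snd = 1 ∧ ofWalk p d.fst d.snd = 0 := by
      intro i d hd
      have h1 := hPf i d hd
      have h2 := hf.le_one d.fst d.snd
      rcases ofWalk_cases hp d.fst d.snd with h | ⟨h, _⟩ | ⟨h, e, he, he1, he2⟩
      · exact ⟨by omega, h⟩
      · omega
      · have h3 := hpR e he
        simp only [hR, he1, he2] at h3
        have := hf.antisymm d.fst d.snd
        omega
    have hdisj : ∀ i, p.edges.Disjoint (P i).edges := by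
      intro i e he1 he2
      obtain ⟨d, hd, rfl⟩ := List.mem_map.mp he2
      obtain ⟨d', hd', hdd⟩ := List.mem_map.mp he1
      have h0 := (hz i d hd).2
      have h1 := ofWalk_eq_one_of_mem hp hd'
      rcases SimpleGraph.dart_edge_eq_iff d' d |>.mp hdd with rfl | rfl
      · omega
      · have := ofWalk_antisymm p d.fst d.snd
        simp only [SimpleGraph.Dart.symm_toProd, Prod.fst_swap, Prod.snd_swap] at h1
        omega
    refine ⟨Fin.cons p P, ?_, ?_, ?_⟩
    · intro i
      refine Fin.cases ?_ (fun i => ?_) i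
      · simpa using hp
      · simpa using hP i
    · intro i
      refine Fin.cases ?_ (fun i => ?_) i
      · simpa using hpR
      · simpa using fun d hd => (hz i d hd).1
    · intro i j
      refine Fin.cases ?_ (fun i => ?_) i <;> refine Fin.cases ?_ (fun j => ?_) j
      · simp
      · intro _
        simpa using hdisj j
      · intro _
        simpa using (hdisj i).symm
      · intro h
        simpa using hPd i j (fun h' => h (by rw [h']))

/-- Menger's theorem for edge-disjoint paths. -/
theorem exists_edgeDisjoint_paths [Fintype V] {G : SimpleGraph V} {x a : V} (hxa : x ≠ a) {r : ℕ}
    (hcut : ∀ S : Finset V, x ∈ S → a ∉ S → r ≤ cutCard G S) :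
    ∃ P : Fin r → G.Walk x a, (∀ i, (P i).IsPath) ∧
      ∀ i j, i ≠ j → (P i).edges.Disjoint (P j).edges := by
  obtain ⟨f, hf, hval⟩ := exists_isFlow hxa hcut r le_rfl
  obtain ⟨P, hP, _, hd⟩ := hf.exists_paths hxa r hval
  exact ⟨P, hP, hd⟩

end UnitFlow

/-! ### Uncrossing minimum edge cuts. -/

namespace UnitFlow

variable {V : Type*} [Fintype V]

open scoped Classical in
theorem cutCard_eq_sum (G : SimpleGraph V) (S : Finset V) :
    cutCard G S = ∑ p : V × V, if G.Adj p.1 p.2 ∧ p.1 ∈ S ∧ p.2 ∉ S then 1 else 0 := by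
  rw [← Finset.card_filter, cutCard]
  congr 1
  ext p
  simp
  tauto

open scoped Classical in
theorem cutCard_compl (G : SimpleGraph V) (S : Finset V) : cutCard G Sᶜ = cutCard G S := by
  rw [cutCard_eq_sum, cutCard_eq_sum, ← (Equiv.prodComm V V).sum_comp]
  refine Finset.sum_congr rfl fun p _ => if_congr ?_ rfl rfl
  simp [G.adj_comm, and_comm]

-- Submodularity, which holds edge by edge.
open scoped Classical in
theorem cutCard_inter_add_union_le (G : SimpleGraph V) (A B : Finset V) :
    cutCard G (A ∩ B) + cutCard G (A ∪ B) ≤ cutCard G A + cutCard G B := by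
  simp only [cutCard_eq_sum, ← Finset.sum_add_distrib]
  refine Finset.sum_le_sum fun p _ => ?_
  by_cases h : G.Adj p.1 p.2 <;> by_cases h1 : p.1 ∈ A <;> by_cases h2 : p.1 ∈ B <;>
    by_cases h3 : p.2 ∈ A <;> by_cases h4 : p.2 ∈ B <;> simp [h, h1, h2, h3, h4]

open scoped Classical in
theorem cutCard_sdiff_add_sdiff_le (G : SimpleGraph V) (A B : Finset V) :
    cutCard G (A \ B) + cutCard G (B \ A) ≤ cutCard G A + cutCard G B := by
  have h := cutCard_inter_add_union_le G A Bᶜ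
  rw [cutCard_compl, ← cutCard_compl G (A ∪ Bᶜ)] at h
  rwa [show A \ B = A ∩ Bᶜ from sdiff_eq, show B \ A = (A ∪ Bᶜ)ᶜ by
    ext; simp; tauto]

open scoped Classical in
theorem exists_isMinCut (G : SimpleGraph V) {u w : V} (huw : u ≠ w) : ∃ A : Finset V, u ∈ A ∧ w ∉ A ∧
    ∀ S : Finset V, u ∈ S → w ∉ S → cutCard G A ≤ cutCard G S := by
  obtain ⟨A, hA, hmin⟩ := Finset.exists_min_image
    (Finset.univ.filter fun A : Finset V => u ∈ A ∧ w ∉ A) (cutCard G)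
    ⟨{u}, by simpa using huw.symm⟩
  simp only [Finset.mem_filter, Finset.mem_univ, true_and] at hA hmin
  exact ⟨A, hA.1, hA.2, fun S h1 h2 => hmin S ⟨h1, h2⟩⟩

open scoped Classical in
/-- If any two terminals are separated by a cut with fewer than `r` edges, then such a cut isolates
a terminal. -/
theorem exists_isolating_cut (G : SimpleGraph V) (T : Finset V) {r : ℕ} (hT : 1 < T.card)
    (hcut : ∀ u ∈ T, ∀ w ∈ T, u ≠ w → ∃ S : Finset V, u ∈ S ∧ w ∉ S ∧ cutCard G S < r) :
    ∃ A : Finset V, cutCard G A < r ∧ ∃ v, A ∩ T = {v} := by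
  -- The sides of minimum cuts between pairs of terminals; the one with fewest terminals will
  -- isolate a terminal.
  set F : Finset (Finset V) := Finset.univ.filter fun A => ∃ u w, u ∈ A ∧ w ∉ A ∧ u ∈ T ∧ w ∈ T ∧
    ∀ S : Finset V, u ∈ S → w ∉ S → cutCard G A ≤ cutCard G S with hF
  have hFne : F.Nonempty := by
    obtain ⟨u, hu, w, hw, huw⟩ := Finset.one_lt_card.mp hT
    obtain ⟨A, h1, h2, h3⟩ := exists_isMinCut G huw
    exact ⟨A, Finset.mem_filter.mpr ⟨Finset.mem_univ _, u, w, h1, h2, hu, hw, h3⟩⟩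
  obtain ⟨A, hA, hmin⟩ := Finset.exists_min_image F (fun A => (A ∩ T).card) hFne
  obtain ⟨u, w, huA, hwA, hu, hw, hAmin⟩ := (Finset.mem_filter.mp hA).2
  have hlt : cutCard G A < r := by
    obtain ⟨S, h1, h2, h3⟩ := hcut u hu w hw fun h => hwA (h ▸ huA)
    exact (hAmin S h1 h2).trans_lt h3
  refine ⟨A, hlt, u, ?_⟩
  by_contra hne
  obtain ⟨a, haA, haT, hau⟩ : ∃ a ∈ A, a ∈ T ∧ a ≠ u := by
    by_contra h
    push Not at h
    refine hne (Finset.eq_singleton_iff_unique_mem.mpr ⟨Finset.mem_inter.mpr ⟨huA, hu⟩, ?_⟩)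
    intro z hz
    exact h z (Finset.mem_inter.mp hz).1 (Finset.mem_inter.mp hz).2
  obtain ⟨B, haB, huB, hBmin⟩ := exists_isMinCut G hau
  have key : ∀ D ∈ F, D ⊆ A → ∀ z ∈ A, z ∈ T → z ∉ D → False := by
    intro D hD hDA z hzA hzT hzD
    refine (hmin D hD).not_gt (Finset.card_lt_card ?_)
    refine ⟨Finset.inter_subset_inter_right hDA, fun h => hzD ?_⟩
    exact (Finset.mem_inter.mp (h (Finset.mem_inter.mpr ⟨hzA, hzT⟩))).1
  -- Uncross `A` with a minimum cut `B` between a second terminal `a` and `u`. According to the side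
  -- of `w`, either `A \ B` or `A ∩ B` is again a minimum cut between `u` and `a`, and it contains
  -- fewer terminals than `A`.
  by_cases hwB : w ∈ B
  · have h1 := cutCard_sdiff_add_sdiff_le G A B
    have h2 : cutCard G A ≤ cutCard G (B \ A) := by
      rw [← cutCard_compl G (B \ A)]
      exact hAmin _ (by simp [huB]) (by simp [hwA, hwB])
    refine key (A \ B) ?_ Finset.sdiff_subset a haA haT (by simp [haB])
    refine Finset.mem_filter.mpr ⟨Finset.mem_univ _, u, a, by simp [huA, huB], by simp [haB], hu,
      haT, fun S h3 h4 => ?_⟩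
    have h5 := hBmin Sᶜ (by simpa using h4) (by simpa using h3)
    rw [cutCard_compl] at h5
    omega
  · have h1 := cutCard_inter_add_union_le G A B
    have h2 : cutCard G A ≤ cutCard G (A ∪ B) := hAmin _ (by simp [huA]) (by simp [hwA, hwB])
    refine key (A ∩ B) ?_ Finset.inter_subset_left u huA hu (by simp [huB])
    refine Finset.mem_filter.mpr ⟨Finset.mem_univ _, a, u, by simp [haA, haB], by simp [huB], haT,
      hu, fun S h3 h4 => ?_⟩
    have h5 := hBmin S h3 h4
    omega

end UnitFlow

/-! ### Edge connectivity in critical graphs. -/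

namespace EdgeColoring

open scoped Classical in
/-- A critical graph has two vertices of maximum degree that no smaller cut separates. -/
theorem Critical.exists_edge_connected_pair {V : Type*} [Fintype V] {G : SimpleGraph V} {r : ℕ}
    (hG : Critical G r) : ∃ x a, x ≠ a ∧ G.degree x = r ∧ G.degree a = r ∧
      ∀ S : Finset V, x ∈ S → a ∉ S → r ≤ UnitFlow.cutCard G S := by
  by_contra hcon
  push Not at hcon
  set T : Finset V := Finset.univ.filter fun v => G.degree v = r with hT
  have hTcard : 1 < T.card := by
    obtain ⟨x, y, hxy⟩ := hG.exists_adj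
    refine (hG.two_le_card_full hxy).trans (Finset.card_le_card fun w hw => ?_)
    simpa [hT] using (Finset.mem_filter.mp hw).2
  obtain ⟨A, hA, v, hv⟩ := UnitFlow.exists_isolating_cut G T (r := r) hTcard
    fun u hu w hw huw => hcon u w huw (by simpa [hT] using hu) (by simpa [hT] using hw)
  have hvAT : v ∈ A ∩ T := by simp [hv]
  have hvA := (Finset.mem_inter.mp hvAT).1
  have hvr : G.degree v = r := by simpa [hT] using (Finset.mem_inter.mp hvAT).2
  -- Of the two neighbours of `w` with degree `r`, one is not `v`, hence is outside `A`, where `v`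
  -- is the only vertex of degree `r`.
  have hout : ∀ w, G.Adj v w → ∃ z, G.Adj w z ∧ z ∉ A := by
    intro w hw
    obtain ⟨z, hz, z', hz', hne⟩ := Finset.one_lt_card.mp (hG.two_le_card_full hw.symm)
    simp only [Finset.mem_filter, SimpleGraph.mem_neighborFinset] at hz hz'
    by_contra h
    push Not at h
    have h1 : ∀ p, G.Adj w p → G.degree p = r → p = v := fun p hp hpr => by
      have : p ∈ A ∩ T := Finset.mem_inter.mpr ⟨h p hp, by simpa [hT] using hpr⟩
      simpa [hv] using this
    exact hne ((h1 z hz.1 hz.2).trans (h1 z' hz'.1 hz'.2).symm)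
  choose! g hg using hout
  refine hA.not_ge ?_
  rw [← hvr, ← SimpleGraph.card_neighborFinset_eq_degree, UnitFlow.cutCard]
  -- Every neighbour of `v` thus supplies its own edge of the cut, which makes the cut too large.
  refine Finset.card_le_card_of_injOn (fun w => if w ∈ A then (w, g w) else (v, w)) ?_ ?_
  · intro w hw
    have hw' : G.Adj v w := by simpa using hw
    by_cases hwA : w ∈ A
    · simpa [hwA] using ⟨(hg w hw').2, (hg w hw').1⟩
    · simpa [hwA] using ⟨hvA, hw'⟩
  · intro w hw w' hw' h
    have h1 : G.Adj v w := by simpa using hw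
    have h2 : G.Adj v w' := by simpa using hw'
    by_cases hwA : w ∈ A <;> by_cases hwA' : w' ∈ A <;> simp [hwA, hwA'] at h
    · exact h.1
    · exact absurd h.1.symm h1.ne
    · exact absurd h.1 h2.ne
    · exact h

end EdgeColoring

/-! ### Odd immersions of complete graphs and their lifts to blow-ups. -/

section OddClique

variable {E E' : Type*}

/-- The graph `L` has a totally odd strong immersion, with all paths inside `S`, of the complete
graph on the ordered set `W`. -/
def OddClique (L : SimpleGraph E) (S : Set E) (W : Type*) [LinearOrder W] : Prop :=
  ∃ (φ : W → E) (Q : ∀ u v : W, u < v → L.Walk (φ u) (φ v)), Function.Injective φ ∧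
    (∀ u, φ u ∈ S) ∧
    (∀ u v h, (Q u v h).IsPath ∧ Odd (Q u v h).length ∧ (∀ e ∈ (Q u v h).support, e ∈ S) ∧
      ∀ e ∈ (Q u v h).support, e ∈ Set.range φ → e = φ u ∨ e = φ v) ∧
    ∀ u v h u' v' h', (u, v) ≠ (u', v') → (Q u v h).edges.Disjoint (Q u' v' h').edges

variable {L : SimpleGraph E} {L' : SimpleGraph E'} {S : Set E} {W W' : Type*} [LinearOrder W]
  [LinearOrder W']

theorem OddClique.exists_graphImmersion (h : OddClique L S W) :
    ∃ I : GraphImmersion (⊤ : SimpleGraph W) L, I.IsStrong ∧ I.IsTotallyOdd := by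
  obtain ⟨φ, Q, hφ, -, hQ, hd⟩ := h
  have hlt : ∀ {u v : W}, (⊤ : SimpleGraph W).Adj u v → ¬ u < v → v < u := fun h h' =>
    lt_of_le_of_ne (not_lt.mp h') (SimpleGraph.top_adj _ _ |>.mp h).symm
  let P : ∀ {u v : W}, (⊤ : SimpleGraph W).Adj u v → L.Walk (φ u) (φ v) := fun {u v} h =>
    if h' : u < v then Q u v h' else (Q v u (hlt h h')).reverse
  have hP : ∀ {u v : W} (h : (⊤ : SimpleGraph W).Adj u v), ∃ p q h', s(p, q) = s(u, v) ∧
      ((P h).IsPath ↔ (Q p q h').IsPath) ∧ (P h).length = (Q p q h').length ∧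
      (∀ e, e ∈ (P h).edges ↔ e ∈ (Q p q h').edges) ∧
      ∀ e, e ∈ (P h).support ↔ e ∈ (Q p q h').support := by
    intro u v h
    by_cases h' : u < v
    · exact ⟨u, v, h', rfl, by simp [P, h']⟩
    · exact ⟨v, u, hlt h h', Sym2.eq_swap, by simp [P, h']⟩
  refine ⟨⟨φ, hφ, P, fun h => ?_, fun {u v} h => ?_, fun {u v u' v'} h h' hne => ?_⟩,
    fun {u v} h e he hr => ?_, fun {u v} h => ?_⟩
  · obtain ⟨p, q, h', -, h1, -⟩ := hP h
    exact h1.mpr (hQ p q h').1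
  · by_cases h' : u < v
    · simp [P, h', h'.not_gt]
    · simp [P, h', hlt h h']
  · obtain ⟨p, q, g, h1, -, -, h2, -⟩ := hP h
    obtain ⟨p', q', g', h1', -, -, h2', -⟩ := hP h'
    intro e he he'
    refine hd p q g p' q' g' ?_ ((h2 e).mp he) ((h2' e).mp he')
    rintro heq
    obtain ⟨rfl, rfl⟩ := Prod.mk.inj heq
    exact hne (h1.symm.trans h1')
  · obtain ⟨p, q, g, h1, -, -, -, h2⟩ := hP h
    have := (hQ p q g).2.2.2 e ((h2 e).mp he) hr
    rcases Sym2.eq_iff.mp h1 with ⟨rfl, rfl⟩ | ⟨rfl, rfl⟩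
    · exact this
    · exact this.symm
  · obtain ⟨p, q, g, -, -, h2, -⟩ := hP h
    change Odd (P h).length
    rw [h2]
    exact (hQ p q g).2.1

theorem OddClique.comp (h : OddClique L S W) (f : W' ↪o W) : OddClique L S W' := by
  obtain ⟨φ, Q, hφ, hS, hQ, hd⟩ := h
  refine ⟨φ ∘ f, fun u v huv => Q (f u) (f v) (f.lt_iff_lt.mpr huv), hφ.comp f.injective,
    fun u => hS _, fun u v huv => ?_, fun u v huv u' v' huv' hne => ?_⟩
  · obtain ⟨h1, h2, h3, h4⟩ := hQ (f u) (f v) (f.lt_iff_lt.mpr huv)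
    exact ⟨h1, h2, h3, fun e he hr => h4 e he (Set.range_comp_subset_range f φ hr)⟩
  · refine hd _ _ _ _ _ _ fun heq => hne ?_
    obtain ⟨h1, h2⟩ := Prod.mk.inj heq
    rw [f.injective h1, f.injective h2]

theorem OddClique.of_card_le [Fintype W] {t : ℕ} (h : OddClique L S W)
    (ht : t ≤ Fintype.card W) : OddClique L S (Fin t) :=
  h.comp ((Fin.castLEOrderEmb ht).trans (Fintype.orderIsoFinOfCardEq W rfl).toOrderEmbedding)

theorem OddClique.map (h : OddClique L S W) (f : L →g L') (hf : Function.Injective f) :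
    OddClique L' Set.univ W := by
  obtain ⟨φ, Q, hφ, hS, hQ, hd⟩ := h
  refine ⟨f ∘ φ, fun u v huv => (Q u v huv).map f, hf.comp hφ, fun _ => trivial,
    fun u v huv => ?_, fun u v huv u' v' huv' hne => ?_⟩
  · obtain ⟨h1, h2, -, h4⟩ := hQ u v huv
    refine ⟨h1.map hf, by simpa using h2, fun _ _ => trivial, ?_⟩
    rintro e he ⟨w, rfl⟩
    rw [SimpleGraph.Walk.support_map, List.mem_map] at he
    obtain ⟨e', he', heq⟩ := he
    exact (h4 e' he' ⟨w, (hf heq).symm⟩).imp (fun h => by rw [← heq, h]; rfl)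
      (fun h => by rw [← heq, h]; rfl)
  · intro e he he'
    rw [SimpleGraph.Walk.edges_map, List.mem_map] at he he'
    obtain ⟨p, hp, rfl⟩ := he
    obtain ⟨q, hq, hpq⟩ := he'
    have := Sym2.map.injective hf hpq
    subst this
    exact hd u v huv u' v' huv' hne hp hq

theorem OddClique.induce (h : OddClique L S W) : OddClique (L.induce S) Set.univ W := by
  obtain ⟨φ, Q, hφ, hS, hQ, hd⟩ := h
  have hmap : ∀ u v huv, ((Q u v huv).induce S (hQ u v huv).2.2.1).map
      (SimpleGraph.Embedding.induce S).toHom = Q u v huv := fun u v huv =>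
    SimpleGraph.Walk.map_induce _ _
  have hedges : ∀ u v huv, ((Q u v huv).induce S (hQ u v huv).2.2.1).edges.map
      (Sym2.map (SimpleGraph.Embedding.induce (G := L) S).toHom) = (Q u v huv).edges :=
    fun u v huv => (SimpleGraph.Walk.edges_map _ _).symm.trans
      (congrArg SimpleGraph.Walk.edges (hmap u v huv))
  refine ⟨fun u => ⟨φ u, hS u⟩, fun u v huv => (Q u v huv).induce S (hQ u v huv).2.2.1,
    fun u v huv => hφ (congrArg Subtype.val huv), fun _ => trivial, fun u v huv => ?_,
    fun u v huv u' v' huv' hne => ?_⟩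
  · obtain ⟨h1, h2, h3, h4⟩ := hQ u v huv
    refine ⟨?_, ?_, fun _ _ => trivial, ?_⟩
    · refine SimpleGraph.Walk.IsPath.of_map (f := (SimpleGraph.Embedding.induce S).toHom) ?_
      rw [hmap]
      exact h1
    · rw [← SimpleGraph.Walk.length_map (SimpleGraph.Embedding.induce S).toHom, hmap]
      exact h2
    · rintro e he ⟨w, rfl⟩
      have he' := List.mem_map_of_mem (f := (SimpleGraph.Embedding.induce (G := L) S).toHom) he
      rw [← SimpleGraph.Walk.support_map, hmap] at he'
      exact (h4 _ he' ⟨w, rfl⟩).imp (fun h => Subtype.ext h) (fun h => Subtype.ext h)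
  · intro e he he'
    refine hd u v huv u' v' huv' hne
      (a := e.map (SimpleGraph.Embedding.induce (G := L) S).toHom) ?_ ?_
    · rw [← hedges u v huv]
      exact List.mem_map_of_mem he
    · rw [← hedges u' v' huv']
      exact List.mem_map_of_mem he'

/-- The lexicographic product of `L` with a complete graph on `m` vertices. -/
def blowup (L : SimpleGraph E) (m : ℕ) : SimpleGraph (E × Fin m) where
  Adj p q := L.Adj p.1 q.1 ∨ (p.1 = q.1 ∧ p.2 ≠ q.2)
  symm := ⟨fun _ _ h => h.imp SimpleGraph.Adj.symm fun h => ⟨h.1.symm, h.2.symm⟩⟩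
  loopless := ⟨fun _ h => h.elim (fun h => h.ne rfl) fun h => h.2 rfl⟩

/-- The lift of a walk to the blow-up that alternates between the layers `i` and `j`. -/
theorem exists_zigzag {m : ℕ} {a b : E} (w : L.Walk a b) : ∀ i j k : Fin m,
    (Even w.length → k = i) → (Odd w.length → k = j) →
    ∃ w' : (blowup L m).Walk (a, i) (b, k), w'.support.map Prod.fst = w.support ∧
      w'.length = w.length ∧
      (∀ p ∈ w'.support, ∃ n ≤ w.length, p.1 = w.getVert n ∧
        ((Even n ∧ p.2 = i) ∨ (Odd n ∧ p.2 = j))) ∧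
      ∀ e ∈ w'.edges, ∃ n ≤ w.length, ∃ l ≤ w.length, Even n ∧ Odd l ∧
        s(w.getVert n, w.getVert l) ∈ w.edges ∧ e = s((w.getVert n, i), (w.getVert l, j)) := by
  induction w with
  | nil =>
    intro i j k hk _
    obtain rfl := hk (by simp)
    exact ⟨.nil, by simp⟩
  | @cons a v b hadj w ih =>
    intro i j k hk1 hk2
    obtain ⟨w', h1, h2, h3, h4⟩ := ih j i k
      (fun h => hk2 (by rw [SimpleGraph.Walk.length_cons]; exact h.add_one))
      (fun h => hk1 (by rw [SimpleGraph.Walk.length_cons]; exact h.add_one))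
    have hadj' : (blowup L m).Adj (a, i) (v, j) := Or.inl hadj
    refine ⟨.cons hadj' w', by simp [h1], by simp [h2], ?_, ?_⟩
    · intro p hp
      rw [SimpleGraph.Walk.support_cons, List.mem_cons] at hp
      rcases hp with rfl | hp
      · exact ⟨0, by simp, by simp⟩
      · obtain ⟨n, hn, h5, h6⟩ := h3 p hp
        refine ⟨n + 1, by simpa using hn, by simpa using h5, ?_⟩
        rcases h6 with ⟨h6, h7⟩ | ⟨h6, h7⟩
        · exact .inr ⟨h6.add_one, h7⟩
        · exact .inl ⟨h6.add_one, h7⟩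
    · intro e he
      rw [SimpleGraph.Walk.edges_cons, List.mem_cons] at he
      rcases he with rfl | he
      · exact ⟨0, by simp, 1, by simp, by simp⟩
      · obtain ⟨n, hn, l, hl, h5, h6, h7, h8⟩ := h4 e he
        refine ⟨l + 1, by simpa using hl, n + 1, by simpa using hn, h6.add_one, h5.add_one, ?_, ?_⟩
        · simp only [SimpleGraph.Walk.getVert_cons_succ, SimpleGraph.Walk.edges_cons, List.mem_cons]
          exact .inr (by rwa [Sym2.eq_swap])
        · simp only [SimpleGraph.Walk.getVert_cons_succ]
          rw [h8, Sym2.eq_swap]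

/-- A totally odd strong immersion of a complete graph lifts to the blow-ups. -/
theorem OddClique.blowup (h : OddClique L Set.univ W) (m : ℕ) :
    OddClique (blowup L m) Set.univ (W ×ₗ Fin m) := by
  obtain ⟨φ, Q, hφ, -, hQ, hd⟩ := h
  have key : ∀ p q : W ×ₗ Fin m, p < q → ∃ w : (_root_.blowup L m).Walk
      (φ (ofLex p).1, (ofLex p).2) (φ (ofLex q).1, (ofLex q).2), w.IsPath ∧ Odd w.length ∧
      (∀ e ∈ w.support, e.1 ∈ Set.range φ → e = (φ (ofLex p).1, (ofLex p).2) ∨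
        e = (φ (ofLex q).1, (ofLex q).2)) ∧
      ∀ e ∈ w.edges, (∃ hlt : (ofLex p).1 < (ofLex q).1,
          ∃ n ≤ (Q _ _ hlt).length, ∃ l ≤ (Q _ _ hlt).length, Even n ∧ Odd l ∧
          s((Q _ _ hlt).getVert n, (Q _ _ hlt).getVert l) ∈ (Q _ _ hlt).edges ∧
          e = s(((Q _ _ hlt).getVert n, (ofLex p).2), ((Q _ _ hlt).getVert l, (ofLex q).2))) ∨
        ((ofLex p).1 = (ofLex q).1 ∧ (ofLex p).2 < (ofLex q).2 ∧
          e = s((φ (ofLex p).1, (ofLex p).2), (φ (ofLex p).1, (ofLex q).2))) := by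
    intro p q hpq
    rcases Prod.Lex.lt_iff.mp hpq with hlt | ⟨heq, hlt⟩
    · obtain ⟨h1, h2, -, h4⟩ := hQ _ _ hlt
      obtain ⟨w, g1, g2, g3, g4⟩ := exists_zigzag (Q _ _ hlt) (ofLex p).2 (ofLex q).2 (ofLex q).2
        (fun h => absurd h2 (Nat.not_odd_iff_even.mpr h)) fun _ => rfl
      refine ⟨w, ?_, by rwa [g2], ?_, fun e he => .inl ⟨hlt, g4 e he⟩⟩
      · rw [SimpleGraph.Walk.isPath_def]
        refine List.Nodup.of_map Prod.fst ?_
        rw [g1]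
        exact h1.support_nodup
      · rintro e he hr
        have hes : e.1 ∈ (Q _ _ hlt).support := by
          rw [← g1]
          exact List.mem_map_of_mem he
        obtain ⟨n, hn, g5, g6⟩ := g3 e he
        -- A vertex of the lift that projects to a terminal is at position zero or at the last, odd
        -- position; parity fixes its layer, so it is an end of the lift.
        rcases h4 _ hes hr with h5 | h5
        · have hn0 : n = 0 := h1.getVert_injOn (by simpa using hn) (by simp) (by
            rw [← g5, h5, SimpleGraph.Walk.getVert_zero])
          subst hn0
          rcases g6 with g6 | g6
          · exact .inl (Prod.ext h5 g6.2)
          · exact absurd g6.1 (by decide)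
        · have hn0 : n = (Q _ _ hlt).length := h1.getVert_injOn (by simpa using hn) (by simp) (by
            rw [← g5, h5, SimpleGraph.Walk.getVert_length])
          subst hn0
          rcases g6 with g6 | g6
          · exact absurd h2 (Nat.not_odd_iff_even.mpr g6.1)
          · exact .inr (Prod.ext h5 g6.2)
    · have hadj : (_root_.blowup L m).Adj (φ (ofLex p).1, (ofLex p).2)
          (φ (ofLex q).1, (ofLex q).2) := .inr ⟨by rw [heq], hlt.ne⟩
      refine ⟨hadj.toWalk, ?_, by simp, ?_, ?_⟩
      · simpa using hadj.ne
      · intro e he _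
        simpa using he
      · intro e he
        refine .inr ⟨heq, hlt, ?_⟩
        rw [heq]
        simpa [heq] using he
  choose w hw using key
  refine ⟨fun p => (φ (ofLex p).1, (ofLex p).2), w, ?_, fun _ => trivial, fun p q hpq => ?_,
    fun p q hpq p' q' hpq' hne => ?_⟩
  · intro p q h
    obtain ⟨h1, h2⟩ := Prod.mk.inj h
    exact ofLex.injective (Prod.ext (hφ h1) h2)
  · obtain ⟨h1, h2, h3, -⟩ := hw p q hpq
    refine ⟨h1, h2, fun _ _ => trivial, ?_⟩
    rintro e he ⟨z, rfl⟩
    exact h3 _ he ⟨_, rfl⟩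
  · intro e he he'
    obtain ⟨⟨u, i⟩, rfl⟩ := toLex.surjective p
    obtain ⟨⟨v, j⟩, rfl⟩ := toLex.surjective q
    obtain ⟨⟨u', i'⟩, rfl⟩ := toLex.surjective p'
    obtain ⟨⟨v', j'⟩, rfl⟩ := toLex.surjective q'
    have h1 := (hw _ _ hpq).2.2.2 e he
    have h2 := (hw _ _ hpq').2.2.2 e he'
    simp only [ofLex_toLex] at h1 h2
    rcases h1 with ⟨hlt, n, hn, l, hl, hne1, hol, hmem, rfl⟩ | ⟨rfl, hij, rfl⟩
    · rcases h2 with ⟨hlt', n', hn', l', hl', hne', hol', hmem', heq⟩ | ⟨rfl, hij', heq⟩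
      · by_cases huv : (u, v) = (u', v')
        -- For two lifts of one path, the even end of a common edge shows the first layer and the
        -- odd end the second, so the layers agree; matching an even end with an odd one is
        -- impossible.
        · obtain ⟨rfl, rfl⟩ := Prod.mk.inj huv
          have hinj := (hQ u v hlt).1.getVert_injOn
          rcases Sym2.eq_iff.mp heq with ⟨h3, h4⟩ | ⟨h3, h4⟩
          · rw [(Prod.mk.inj h3).2, (Prod.mk.inj h4).2] at hne
            exact hne rfl
          · have := hinj (by simpa using hn) (by simpa using hl') (Prod.mk.inj h3).1
            subst this
            exact Nat.not_odd_iff_even.mpr hne1 hol'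
        · refine hd u v hlt u' v' hlt' huv hmem ?_
          have := congrArg (Sym2.map Prod.fst) heq
          simp only [Sym2.map_mk] at this
          rw [this]
          exact hmem'
      · have := congrArg (Sym2.map Prod.fst) heq
        simp only [Sym2.map_mk] at this
        rw [this] at hmem
        exact ((Q u v hlt).adj_of_mem_edges hmem).ne rfl
    · rcases h2 with ⟨hlt', n', hn', l', hl', hne', hol', hmem', heq⟩ | ⟨rfl, hij', heq⟩
      · have := congrArg (Sym2.map Prod.fst) heq
        simp only [Sym2.map_mk] at this
        rw [← this] at hmem'
        exact ((Q u' v' hlt').adj_of_mem_edges hmem').ne rfl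
      · rcases Sym2.eq_iff.mp heq with ⟨h3, h4⟩ | ⟨h3, h4⟩
        · obtain ⟨h5, rfl⟩ := Prod.mk.inj h3
          obtain ⟨-, rfl⟩ := Prod.mk.inj h4
          obtain rfl := hφ h5
          exact hne rfl
        · obtain ⟨-, rfl⟩ := Prod.mk.inj h3
          obtain ⟨-, rfl⟩ := Prod.mk.inj h4
          exact absurd hij hij'.not_gt

theorem blowup_colorable {s : ℕ} (h : L.Colorable s) (m : ℕ) : (blowup L m).Colorable (s * m) := by
  obtain ⟨c⟩ := h
  have hc : ∀ {p q}, (blowup L m).Adj p q → (c p.1, p.2) ≠ (c q.1, q.2) := by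
    rintro p q (h | ⟨-, h⟩) heq
    · exact c.valid h (Prod.mk.inj heq).1
    · exact h (Prod.mk.inj heq).2
  simpa using (SimpleGraph.Coloring.mk (fun p : E × Fin m => (c p.1, p.2)) hc).colorable

end OddClique

/-! ### From paths of a graph to odd paths of its line graph. -/

section LineGraphPaths

variable {V : Type*}

/-- Two distinct unordered pairs are adjacent if they have a common element. -/
def meetGraph (V : Type*) : SimpleGraph (Sym2 V) where
  Adj e f := e ≠ f ∧ ∃ v, v ∈ e ∧ v ∈ f
  symm := ⟨fun _ _ h => ⟨h.1.symm, h.2.imp fun _ => And.symm⟩⟩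
  loopless := ⟨fun _ h => h.1 rfl⟩

theorem SimpleGraph.exists_walk_of_isChain {E : Type*} {L : SimpleGraph E} {T : E → E → Prop} :
    ∀ (l : List E) (a b : E), (a :: l).IsChain (fun p q => L.Adj p q ∧ T p q) →
      (a :: l).getLast (List.cons_ne_nil _ _) = b →
      ∃ w : L.Walk a b, w.support = a :: l ∧ ∀ e ∈ w.edges, ∃ p q, e = s(p, q) ∧ T p q
  | [], a, b, _, hb => by
    obtain rfl : a = b := by simpa using hb
    exact ⟨.nil, by simp⟩
  | c :: l, a, b, hc, hb => by
    rw [List.isChain_cons_cons] at hc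
    obtain ⟨w, h1, h2⟩ := exists_walk_of_isChain l c b hc.2 (by simpa using hb)
    refine ⟨.cons hc.1.1 w, by simp [h1], fun e he => ?_⟩
    rw [SimpleGraph.Walk.edges_cons, List.mem_cons] at he
    rcases he with rfl | he
    · exact ⟨a, c, rfl, hc.1.2⟩
    · exact h2 e he

theorem List.IsChain.and_mem {E : Type*} {R : E → E → Prop} {S : E → Prop} :
    ∀ {l : List E}, l.IsChain R → (∀ e ∈ l, S e) → l.IsChain fun p q => R p q ∧ S p ∧ S q
  | [], _, _ => List.IsChain.nil
  | [_], _, _ => List.IsChain.singleton _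
  | a :: b :: l, h, hS => by
    rw [List.isChain_cons_cons] at h ⊢
    exact ⟨⟨h.1, hS a (by simp), hS b (by simp)⟩,
      h.2.and_mem fun e he => hS e (List.mem_cons_of_mem _ he)⟩

variable {G : SimpleGraph V}

theorem SimpleGraph.Walk.isChain_edges {u v : V} {p : G.Walk u v} (hp : p.IsPath) :
    p.edges.IsChain (meetGraph V).Adj := by
  induction p with
  | nil => simp
  | @cons u v w h p ih =>
    rw [SimpleGraph.Walk.cons_isPath_iff] at hp
    cases p with
    | nil => simp
    | @cons _ z _ h' p =>
      rw [SimpleGraph.Walk.edges_cons, SimpleGraph.Walk.edges_cons, List.isChain_cons_cons]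
      refine ⟨⟨fun heq => ?_, v, by simp, by simp⟩, by simpa using ih hp.1⟩
      rw [Sym2.eq_swap, Sym2.congr_right] at heq
      exact hp.2 (by simp [heq])

theorem SimpleGraph.Walk.mem_of_mem_getLast?_edges {u v : V} {p : G.Walk u v} :
    ∀ e ∈ p.edges.getLast?, v ∈ e := by
  induction p with
  | nil => simp
  | @cons u v w h p ih =>
    cases p with
    | nil => simp
    | cons h' p =>
      intro e he
      refine ih e ?_
      rw [SimpleGraph.Walk.edges_cons] at he
      simpa using he

theorem SimpleGraph.Walk.notMem_of_mem_edges {u v z : V} {p : G.Walk u v} (hz : z ∉ p.support)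
    {e : Sym2 V} (he : e ∈ p.edges) : z ∉ e := by
  intro hze
  obtain ⟨w, rfl⟩ := hze
  exact hz (p.fst_mem_support_of_mem_edges he)

/-- The last two edges of a path. -/
theorem SimpleGraph.Walk.exists_edges_eq_append {u v : V} {p : G.Walk u v} (hp : p.IsPath)
    (hlen : 2 ≤ p.length) : ∃ l b c, p.edges = l ++ [s(b, c), s(b, v)] ∧ c ≠ v ∧ b ≠ v := by
  have key : ∀ q : G.Walk v u, q.IsPath → 2 ≤ q.length →
      ∃ l b c, q.edges = s(b, v) :: s(b, c) :: l ∧ c ≠ v ∧ b ≠ v := by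
    intro q hq hlen
    cases q with
    | nil => simp at hlen
    | @cons _ b _ h q =>
      cases q with
      | nil => simp at hlen
      | @cons _ c _ h' q =>
        rw [SimpleGraph.Walk.cons_isPath_iff] at hq
        refine ⟨q.edges, b, c, by simp [Sym2.eq_swap], ?_, h.ne'⟩
        rintro rfl
        exact hq.2 (by simp)
  obtain ⟨l, b, c, h1, h2, h3⟩ := key p.reverse hp.reverse (by simpa using hlen)
  refine ⟨l.reverse, b, c, ?_, h2, h3⟩
  rw [SimpleGraph.Walk.edges_reverse, List.reverse_eq_iff] at h1
  simpa using h1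

/-- The pairs of consecutive edges in a path of the line graph that follows the path with edges `E`
from its second vertex `y` to its end `a`, possibly with a detour at `y` and with a last step
to `h`. -/
def PathStep (E : List (Sym2 V)) (y a : V) (h : Sym2 V) (e : Sym2 (Sym2 V)) : Prop :=
  ∃ f ∈ E, ∃ g, e = s(f, g) ∧ (g ∈ E ∨ (a ∈ f ∧ g = h ∧ h ∉ E) ∨
    (y ≠ a ∧ y ∈ f ∧ y ∈ g ∧ g ∉ E ∧ g ≠ h))

/-- Prolong a path of the line graph to `h`, with even number of vertices. -/
theorem exists_even_list {x y a : V} (hxy : G.Adj x y) (p : G.Walk y a)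
    (hp : (SimpleGraph.Walk.cons hxy p).IsPath) {h : Sym2 V} (hG : h ∈ G.edgeSet) (hxh : x ∉ h)
    (hah : a ∈ h) (t : List (Sym2 V))
    (ht : (t = [] ∧ ∃ l, (SimpleGraph.Walk.cons hxy p).edges = l ++ [h]) ∨
      (t = [h] ∧ h ∉ (SimpleGraph.Walk.cons hxy p).edges))
    (hflip : Even (p.length + 1 + t.length) ∨ (y ≠ a ∧ ∃ z, G.Adj y z ∧ z ≠ x ∧
      s(y, z) ∉ (SimpleGraph.Walk.cons hxy p).edges ∧ s(y, z) ≠ h)) :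
    ∃ l : List (Sym2 V), (s(x, y) :: l).IsChain (fun e f => (meetGraph V).Adj e f ∧
        PathStep (SimpleGraph.Walk.cons hxy p).edges y a h s(e, f)) ∧
      (s(x, y) :: l).Nodup ∧ Even (l.length + 1) ∧
      (s(x, y) :: l).getLast (List.cons_ne_nil _ _) = h ∧ ∀ e ∈ l, e ∈ G.edgeSet ∧ x ∉ e := by
  set E := (SimpleGraph.Walk.cons hxy p).edges with hE
  have hEcons : E = s(x, y) :: p.edges := by simp [hE]
  have hnd : E.Nodup := hp.isTrail.edges_nodup
  have hchain : E.IsChain fun e f => (meetGraph V).Adj e f ∧ PathStep E y a h s(e, f) :=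
    ((SimpleGraph.Walk.isChain_edges hp).and_mem (S := fun e => e ∈ E) fun e he => he).imp
      fun e f hef => ⟨hef.1, e, hef.2.1, f, rfl, .inl hef.2.2⟩
  have hB : (s(x, y) :: (p.edges ++ t)).IsChain
      (fun e f => (meetGraph V).Adj e f ∧ PathStep E y a h s(e, f)) ∧
      (s(x, y) :: (p.edges ++ t)).Nodup ∧
      (s(x, y) :: (p.edges ++ t)).getLast (List.cons_ne_nil _ _) = h := by
    rcases ht with ⟨rfl, l, hl⟩ | ⟨rfl, hh⟩
    · simp only [List.append_nil, ← hEcons]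
      exact ⟨hchain, hnd, by simp [hl]⟩
    · simp only [← List.cons_append, ← hEcons]
      refine ⟨?_, by
        simpa [List.nodup_append, hnd] using fun e he heq => hh (by rwa [← heq]), by simp⟩
      rw [List.isChain_append]
      refine ⟨hchain, by simp, ?_⟩
      intro e he f hf
      obtain rfl : h = f := by simpa using hf
      have he' : e ∈ E := List.mem_of_mem_getLast? he
      have hae := SimpleGraph.Walk.mem_of_mem_getLast?_edges e he
      exact ⟨⟨fun heq => hh (heq ▸ he'), a, hae, hah⟩, e, he', h, rfl, .inr (.inl ⟨hae, rfl, hh⟩)⟩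
  have hmem : ∀ e ∈ p.edges ++ t, e ∈ G.edgeSet ∧ x ∉ e := by
    intro e he
    rcases List.mem_append.mp he with he | he
    · refine ⟨p.edges_subset_edgeSet he, SimpleGraph.Walk.notMem_of_mem_edges ?_ he⟩
      exact ((SimpleGraph.Walk.cons_isPath_iff _ _).mp hp).2
    · obtain rfl : e = h := by
        rcases ht with ⟨rfl, -⟩ | ⟨rfl, -⟩
        · simp at he
        · simpa using he
      exact ⟨hG, hxh⟩
  -- An even number of vertices means odd length. In the other case `s(y, z)` is inserted between
  -- the first two edges of the path, all three of which meet at `y`.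
  by_cases hev : Even (p.length + 1 + t.length)
  · refine ⟨p.edges ++ t, hB.1, hB.2.1, ?_, hB.2.2, hmem⟩
    have : (p.edges ++ t).length + 1 = p.length + 1 + t.length := by
      simp
      omega
    rwa [this]
  · obtain ⟨hya, z, hyz, hzx, hzE, hzh⟩ := hflip.resolve_left hev
    obtain ⟨f, l, hf⟩ : ∃ f l, p.edges = f :: l ∧ y ∈ f := by
      cases p with
      | nil => exact absurd rfl hya
      | cons h' p => exact ⟨_, _, SimpleGraph.Walk.edges_cons _ _, by simp⟩
    obtain ⟨hpl, hyf⟩ := hf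
    have hfE : f ∈ E := by simp [hEcons, hpl]
    have heE : s(x, y) ∈ E := by simp [hEcons]
    have hzt : s(y, z) ∉ t := by
      rcases ht with ⟨rfl, -⟩ | ⟨rfl, -⟩
      · simp
      · simpa using hzh
    have hzp : s(y, z) ∉ p.edges := fun h => hzE (by simp [hEcons, h])
    have hne : ∀ e ∈ E, e ≠ s(y, z) := fun e he heq => hzE (heq ▸ he)
    refine ⟨s(y, z) :: (p.edges ++ t), ?_, ?_, ?_, ?_, ?_⟩
    · have h1 := hB.1
      rw [hpl, List.cons_append, List.isChain_cons_cons] at h1 ⊢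
      rw [List.isChain_cons_cons]
      exact ⟨⟨⟨hne _ heE, y, by simp, by simp⟩, _, heE, _, rfl,
        .inr (.inr ⟨hya, by simp, by simp, hzE, hzh⟩)⟩, ⟨⟨(hne _ hfE).symm, y, by simp, hyf⟩,
        _, hfE, _, Sym2.eq_swap, .inr (.inr ⟨hya, hyf, by simp, hzE, hzh⟩)⟩, h1.2⟩
    · have h1 := hB.2.1
      rw [List.nodup_cons] at h1 ⊢
      rw [List.nodup_cons, List.mem_cons, not_or]
      refine ⟨⟨hne _ heE, h1.1⟩, ?_, h1.2⟩
      rw [List.mem_append, not_or]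
      exact ⟨hzp, hzt⟩
    · have : (s(y, z) :: (p.edges ++ t)).length + 1 = p.length + 1 + t.length + 1 := by
        simp
        omega
      rw [this]
      exact (Nat.not_even_iff_odd.mp hev).add_one
    · have h1 := hB.2.2
      rw [List.getLast_cons (by simp)]
      rw [List.getLast_cons (by simp [hpl])] at h1 ⊢
      exact h1
    · intro e he
      rcases List.mem_cons.mp he with rfl | he
      · refine ⟨hyz, ?_⟩
        simpa using ⟨hxy.ne, hzx.symm⟩
      · exact hmem e he

/-- Each step has an end in its own path, so a common step would join an edge of `E` to an edge of
`E'`, using a detour or the last step to `h` on both sides. Two edges that share two distinct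
vertices coincide, which excludes the cases with a detour. -/
theorem PathStep.disjoint {E E' : List (Sym2 V)} {y y' a : V} {h : Sym2 V} {e : Sym2 (Sym2 V)}
    (hE : E.Disjoint E') (hy : y ≠ y') (hah : a ∈ h) (hs : PathStep E y a h e) :
    ¬ PathStep E' y' a h e := by
  rintro ⟨f', hf', g', rfl, hg'⟩
  obtain ⟨f, hf, g, heq, hg⟩ := hs
  rcases Sym2.eq_iff.mp heq with ⟨rfl, -⟩ | ⟨rfl, rfl⟩
  · exact hE hf hf'
  rcases hg with hg | ⟨haf, rfl, hhE⟩ | ⟨hya, hyf, hyg, -, hgh⟩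
  · exact hE hg hf'
  · rcases hg' with hg' | ⟨-, rfl, -⟩ | ⟨hya', hyf', hyg', -, hgh'⟩
    · exact hE hf hg'
    · exact hhE hf
    · exact hgh' (((Sym2.mem_and_mem_iff hya').mp ⟨hyg', haf⟩).trans
        ((Sym2.mem_and_mem_iff hya').mp ⟨hyf', hah⟩).symm)
  · rcases hg' with hg' | ⟨haf', rfl, hhE⟩ | ⟨-, hyf', hyg', -, -⟩
    · exact hE hf hg'
    · exact hgh (((Sym2.mem_and_mem_iff hya).mp ⟨hyg, haf'⟩).trans
        ((Sym2.mem_and_mem_iff hya).mp ⟨hyf, hah⟩).symm)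
    · have h1 := ((Sym2.mem_and_mem_iff hy).mp ⟨hyf, hyg'⟩).trans
        ((Sym2.mem_and_mem_iff hy).mp ⟨hyg, hyf'⟩).symm
      exact hE hf (h1 ▸ hf')

end LineGraphPaths

/-! ### Odd immersions from edge-disjoint paths. -/

section LineGraphPaths

variable {V : Type*} {G : SimpleGraph V}

open scoped Classical in
/-- Edge-disjoint paths between two vertices yield an odd immersion of a complete graph in the line
graph, if all but one of them are odd; for the other paths it is enough that a detour is possible
at the second vertex. -/
theorem oddClique_of_paths [Fintype V] {x a : V} (hxa : x ≠ a) {r : ℕ} (P : Fin r → G.Walk x a)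
    (hP : ∀ i, (P i).IsPath) (hd : ∀ i k, i ≠ k → (P i).edges.Disjoint (P k).edges) (j : Fin r)
    (hj : 2 ≤ (P j).length)
    (hpar : ∀ i, (Even (P i).length ↔ i = j) ∨ 3 ≤ G.degree ((P i).getVert 1)) :
    OddClique (meetGraph V) G.edgeSet (WithTop (Fin r)) := by
  have hcons : ∀ w : G.Walk x a, ∃ (y : V) (h : G.Adj x y) (p : G.Walk y a), w = .cons h p := by
    intro w
    cases w with
    | nil => exact absurd rfl hxa
    | cons h p => exact ⟨_, h, p, rfl⟩
  choose y hxy p hPp using fun i => hcons (P i)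
  obtain ⟨l, b, c, hl, hca, hba⟩ := SimpleGraph.Walk.exists_edges_eq_append (hP j) hj
  set h : Sym2 V := s(b, a) with hh
  have hhj : h ∈ (P j).edges := by simp [hl]
  have hbc : s(b, c) ∈ (P j).edges := by simp [hl]
  have hhE : ∀ i, i ≠ j → h ∉ (P i).edges := fun i hi hmem => hd i j hi hmem hhj
  have hfirst : ∀ i, s(x, y i) ∈ (P i).edges := fun i => by simp [hPp i]
  have hPc : ∀ i, (SimpleGraph.Walk.cons (hxy i) (p i)).IsPath := fun i => hPp i ▸ hP i
  have hxe : ∀ i, ∀ e ∈ (P i).edges, x ∈ e → e = s(x, y i) := by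
    intro i e he hxe
    rw [hPp i, SimpleGraph.Walk.edges_cons, List.mem_cons] at he
    refine he.resolve_right fun he => SimpleGraph.Walk.notMem_of_mem_edges ?_ he hxe
    exact ((SimpleGraph.Walk.cons_isPath_iff _ _).mp (hPc i)).2
  have hxh : x ∉ h := by
    intro hx
    have hbx : b = x := by
      rcases Sym2.mem_iff.mp hx with h1 | h1
      · exact h1.symm
      · exact absurd h1 hxa
    have h1 := hxe j _ hhj hx
    have h2 := hxe j _ hbc (by simp [hbx])
    exact hca (Sym2.congr_right.mp (h2.trans h1.symm))
  have hyinj : Function.Injective y := by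
    intro i k hik
    by_contra hne
    exact hd i k hne (hfirst i) (by rw [hik]; exact hfirst k)
  have hz : ∀ i, y i ≠ a → 3 ≤ G.degree (y i) → ∃ z, G.Adj (y i) z ∧ z ≠ x ∧
      s(y i, z) ∉ (P i).edges ∧ s(y i, z) ≠ h := by
    intro i hya hdeg
    -- The path uses only two edges at its second vertex, so degree three leaves a neighbour for the
    -- detour.
    obtain ⟨z', hz'⟩ : ∃ z', ∀ e ∈ (P i).edges, y i ∈ e → e = s(y i, x) ∨ e = s(y i, z') := by
      have h1 := hPc i
      have h2 := hPp i
      generalize p i = q at h1 h2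
      cases q with
      | nil => exact absurd rfl hya
      | @cons _ z' _ h' q =>
        refine ⟨z', fun e he hye => ?_⟩
        rw [h2, SimpleGraph.Walk.edges_cons, SimpleGraph.Walk.edges_cons, List.mem_cons,
          List.mem_cons] at he
        rcases he with rfl | rfl | he
        · exact .inl Sym2.eq_swap
        · exact .inr rfl
        · refine absurd hye (SimpleGraph.Walk.notMem_of_mem_edges ?_ he)
          exact ((SimpleGraph.Walk.cons_isPath_iff _ _).mp
            ((SimpleGraph.Walk.cons_isPath_iff _ _).mp h1).1).2
    obtain ⟨z, hz⟩ : (((G.neighborFinset (y i)).erase x).erase z').Nonempty := by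
      rw [← Finset.card_pos]
      have h1 := Finset.pred_card_le_card_erase (s := G.neighborFinset (y i)) (a := x)
      have h2 := Finset.pred_card_le_card_erase (s := (G.neighborFinset (y i)).erase x) (a := z')
      rw [SimpleGraph.card_neighborFinset_eq_degree] at h1
      omega
    simp only [Finset.mem_erase, SimpleGraph.mem_neighborFinset] at hz
    obtain ⟨hzz', hzx, hyz⟩ := hz
    have hzE : s(y i, z) ∉ (P i).edges := fun hmem => by
      rcases hz' _ hmem (by simp) with h1 | h1
      · exact hzx (Sym2.congr_right.mp h1)
      · exact hzz' (Sym2.congr_right.mp h1)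
    -- If the spare edge is `h` itself, then `y i = b`, and the edge `s(b, c)` that precedes `h` on
    -- `P j` serves instead.
    by_cases hzh : s(y i, z) = h
    · have hij : i ≠ j := by
        rintro rfl
        exact hzE (hzh ▸ hhj)
      have hyb : y i = b := by
        rcases Sym2.eq_iff.mp hzh with h1 | h1
        · exact h1.1
        · exact absurd h1.1 hya
      rw [hyb]
      refine ⟨c, (P j).adj_of_mem_edges hbc, ?_, fun hmem => hd i j hij hmem hbc,
        fun heq => hca (Sym2.congr_right.mp heq)⟩
      rintro rfl
      refine hd i j hij (hfirst i) ?_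
      rwa [hyb, Sym2.eq_swap]
    · exact ⟨z, hyz, hzx, hzE, hzh⟩
  have hlist : ∀ i, ∃ w : (meetGraph V).Walk s(x, y i) h, w.IsPath ∧ Odd w.length ∧
      (∀ e ∈ w.support, e ∈ G.edgeSet ∧ (x ∈ e → e = s(x, y i))) ∧
      ∀ e ∈ w.edges, PathStep (P i).edges (y i) a h e := by
    intro i
    have hlen : (P i).length = (p i).length + 1 := by simp [hPp i]
    -- The path `P j` already ends with `h`; the others need one more step. Hence the wanted parity
    -- is even for `P j` and odd for the rest.
    obtain ⟨l', h1, h2, h3, h4, h5⟩ := exists_even_list (hxy i) (p i) (hPc i)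
      ((P j).edges_subset_edgeSet hhj) hxh (by simp [hh]) (if i = j then [] else [h])
      (by
        by_cases hij : i = j
        · subst hij
          refine .inl ⟨by simp, l ++ [s(b, c)], ?_⟩
          rw [← hPp, hl]
          simp
        · exact .inr ⟨by simp [hij], by rw [← hPp]; exact hhE i hij⟩)
      (by
        by_cases hpi : Even (P i).length ↔ i = j
        · left
          rw [hlen] at hpi
          by_cases hij : i = j
          · simpa [hij] using hpi.mpr hij
          · simpa [hij, Nat.even_add_one] using mt hpi.mp hij
        · right
          -- A path whose second vertex is `a` is a single edge; it is odd and differs from `P j`,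
          -- so its parity needs no repair.
          have hya : y i ≠ a := by
            intro hya
            have h1 : (p i).length = 0 := by
              have := ((SimpleGraph.Walk.cons_isPath_iff _ _).mp (hPc i)).1
              generalize p i = q at this
              revert q
              rw [hya]
              intro q hq
              exact SimpleGraph.Walk.length_eq_zero_iff.mpr (SimpleGraph.Walk.isPath_iff_nil.mp hq)
            refine hpi (iff_of_false (by rw [hlen, h1]; decide) ?_)
            rintro rfl
            omega
          have := (hpar i).resolve_left hpi
          rw [hPp i, SimpleGraph.Walk.getVert_cons_succ, SimpleGraph.Walk.getVert_zero] at this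
          obtain ⟨z, hz⟩ := hz i hya this
          exact ⟨hya, z, by rwa [← hPp i]⟩)
    obtain ⟨w, hw1, hw2⟩ := SimpleGraph.exists_walk_of_isChain
      (T := fun e f => PathStep (P i).edges (y i) a h s(e, f)) l' _ _
      (by simpa only [← hPp i] using h1) h4
    refine ⟨w, ?_, ?_, ?_, ?_⟩
    · rw [SimpleGraph.Walk.isPath_def, hw1]
      exact h2
    · have := w.length_support
      rw [hw1, List.length_cons] at this
      rw [this] at h3
      by_contra hodd
      exact Nat.not_even_iff_odd.mpr (Nat.not_odd_iff_even.mp hodd).add_one h3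
    · intro e he
      rw [hw1, List.mem_cons] at he
      rcases he with rfl | he
      · exact ⟨hxy i, fun _ => rfl⟩
      · exact ⟨(h5 e he).1, fun hx => absurd hx (h5 e he).2⟩
    · intro e he
      obtain ⟨f, g, rfl, hT⟩ := hw2 e he
      exact hT
  let φ : WithTop (Fin r) → Sym2 V := fun u => u.recTopCoe h fun i => s(x, y i)
  have hφi : ∀ i : Fin r, φ i = s(x, y i) := fun i => rfl
  have hφt : φ ⊤ = h := rfl
  have hrange : ∀ e ∈ Set.range φ, e = h ∨ x ∈ e := by
    rintro _ ⟨u, rfl⟩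
    induction u using WithTop.recTopCoe with
    | top => exact .inl rfl
    | coe i => exact .inr (by simp [hφi])
  have hφinj : Function.Injective φ := by
    intro u v huv
    induction u using WithTop.recTopCoe with
    | top =>
      induction v using WithTop.recTopCoe with
      | top => rfl
      | coe k =>
        rw [hφi, hφt] at huv
        exact absurd (by rw [huv]; simp) hxh
    | coe i =>
      induction v using WithTop.recTopCoe with
      | top =>
        rw [hφi, hφt] at huv
        exact absurd (by rw [← huv]; simp) hxh
      | coe k =>
        rw [hφi, hφi] at huv
        rw [hyinj (Sym2.congr_right.mp huv)]
  have key : ∀ u v : WithTop (Fin r), u < v → ∃ w : (meetGraph V).Walk (φ u) (φ v), (w.IsPath ∧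
      Odd w.length ∧ (∀ e ∈ w.support, e ∈ G.edgeSet) ∧
      ∀ e ∈ w.support, e ∈ Set.range φ → e = φ u ∨ e = φ v) ∧
      ∀ e ∈ w.edges, (v ≠ ⊤ ∧ e = s(φ u, φ v)) ∨ (v = ⊤ ∧ (∃ f ∈ e, x ∉ f) ∧
        ∃ i : Fin r, u = i ∧ PathStep (P i).edges (y i) a h e) := by
    intro u v huv
    induction u using WithTop.recTopCoe with
    | top => exact absurd huv not_top_lt
    | coe i =>
      induction v using WithTop.recTopCoe with
      | top =>
        obtain ⟨w, h1, h2, h3, h4⟩ := hlist i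
        refine ⟨w, ⟨h1, h2, fun e he => (h3 e he).1, fun e he hr => ?_⟩, fun e he =>
          .inr ⟨rfl, ?_, i, rfl, h4 e he⟩⟩
        · rcases hrange e hr with rfl | hx
          · exact .inr rfl
          · exact .inl ((h3 e he).2 hx)
        · induction e with
          | _ f g =>
            by_contra hno
            push Not at hno
            refine (w.adj_of_mem_edges he).1 ?_
            rw [(h3 f (w.fst_mem_support_of_mem_edges he)).2 (hno f (by simp)),
              (h3 g (w.snd_mem_support_of_mem_edges he)).2 (hno g (by simp))]
      | coe k =>
        have hadj : (meetGraph V).Adj (φ i) (φ k) :=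
          ⟨fun heq => huv.ne (hφinj heq), x, by simp [hφi], by simp [hφi]⟩
        refine ⟨hadj.toWalk, ⟨by simpa using hadj.ne, by simp, ?_, ?_⟩, ?_⟩
        · intro e he
          have : e = φ i ∨ e = φ k := by simpa using he
          rcases this with rfl | rfl
          · exact hxy i
          · exact hxy k
        · intro e he _
          simpa using he
        · intro e he
          exact .inl ⟨WithTop.coe_ne_top, by simpa using he⟩
  choose Q hQ hQe using key
  refine ⟨φ, Q, hφinj, fun u => ?_, hQ, fun u v huv u' v' huv' hne e he he' => ?_⟩
  · induction u using WithTop.recTopCoe with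
    | top => exact (P j).edges_subset_edgeSet hhj
    | coe i => exact hxy i
  -- Both ends of a line-graph edge between star terminals contain `x`, whereas every edge of a path
  -- to `h` has an end that avoids `x`.
  · have hstar : ∀ {u v : WithTop (Fin r)}, u < v → v ≠ ⊤ → ∀ f ∈ s(φ u, φ v), x ∈ f := by
      intro u v huv hv f hf
      lift v to Fin r using hv
      lift u to Fin r using huv.ne_top
      rcases Sym2.mem_iff.mp hf with rfl | rfl
      · simp [hφi]
      · simp [hφi]
    rcases hQe u v huv e he with ⟨hv, rfl⟩ | ⟨rfl, ⟨f, hfe, hxf⟩, i, rfl, hi⟩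
    · rcases hQe u' v' huv' _ he' with ⟨hv', heq⟩ | ⟨rfl, ⟨f, hfe, hxf⟩, i, rfl, hi⟩
      · rcases Sym2.eq_iff.mp heq with ⟨h1, h2⟩ | ⟨h1, h2⟩
        · exact hne (Prod.ext (hφinj h1) (hφinj h2))
        · obtain rfl := hφinj h1
          obtain rfl := hφinj h2
          exact huv.not_gt huv'
      · exact hxf (hstar huv hv f hfe)
    · rcases hQe u' v' huv' _ he' with ⟨hv', rfl⟩ | ⟨rfl, -, k, rfl, hk⟩
      · exact hxf (hstar huv' hv' f hfe)
      · have hik : i ≠ k := fun hik => hne (by rw [hik])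
        exact PathStep.disjoint (hd i k hik) (fun heq => hik (hyinj heq)) (by simp [hh]) hi hk

end LineGraphPaths

/-! ### The immersion for simple graphs. -/

namespace EdgeColoring

variable {V C : Type*}

/-- The parity of a path whose edges have two colours. -/
theorem IsProper.parity {K : SimpleGraph V} {c : Sym2 V → C} (hc : IsProper K c) {u v : V}
    {p : K.Walk u v} (hp : p.IsPath) : ∀ a b : C, (∀ e ∈ p.edges, c e = a ∨ c e = b) →
    (∀ e ∈ p.edges.head?, c e ≠ a) → (Misses K c v b → Even p.length) ∧
      (Misses K c v a → 0 < p.length → Odd p.length) := by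
  induction p with
  | nil => simp
  | @cons u w v h p ih =>
    intro a b hab hhead
    rw [SimpleGraph.Walk.cons_isPath_iff] at hp
    have hcol : c s(u, w) = b := (hab _ (by simp)).resolve_left (hhead _ (by simp))
    cases p with
    | nil =>
      refine ⟨fun hv => absurd ?_ (hv h.symm), fun _ _ => by simp⟩
      rwa [Sym2.eq_swap]
    | @cons _ z _ h' p =>
      obtain ⟨h1, h2⟩ := ih hp.1 b a
        (fun e he => (hab e (by rw [SimpleGraph.Walk.edges_cons]; exact List.mem_cons_of_mem _ he)).symm)
        (by
          intro e he
          obtain rfl : s(w, z) = e := by simpa using he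
          rw [← hcol, Sym2.eq_swap (a := u)]
          refine hc h' h.symm ?_
          rintro rfl
          exact hp.2 (by simp))
      rw [SimpleGraph.Walk.length_cons]
      exact ⟨fun hv => (h2 hv (by simp)).add_one, fun hv _ => (h1 hv).add_one⟩

theorem snd_spec {G : SimpleGraph V} {x a : V} (hxa : x ≠ a) (p : G.Walk x a) :
    G.Adj x (p.getVert 1) ∧ s(x, p.getVert 1) ∈ p.edges ∧ (p.getVert 1 ≠ a → 2 ≤ p.length) := by
  cases p with
  | nil => exact absurd rfl hxa
  | cons h p =>
    rw [SimpleGraph.Walk.getVert_cons_succ, SimpleGraph.Walk.getVert_zero]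
    refine ⟨h, by simp, fun hne => ?_⟩
    cases p with
    | nil => exact absurd rfl hne
    | cons h' p => simp

/-- The line graph of a critical graph has a totally odd strong immersion of a complete graph with
one vertex more than the maximum degree. -/
theorem Critical.oddClique [Fintype V] {G : SimpleGraph V} {r : ℕ} (hG : Critical G r) :
    OddClique (meetGraph V) G.edgeSet (WithTop (Fin r)) := by
  classical
  have hr2 : 2 ≤ r := by
    obtain ⟨x, y, hxy⟩ := hG.exists_adj
    refine (hG.two_le_card_full hxy).trans ((Finset.card_filter_le _ _).trans ?_)
    rw [SimpleGraph.card_neighborFinset_eq_degree]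
    exact hG.degree_le x
  rcases hr2.eq_or_lt with rfl | hr3
  -- For r = 2, the `(a, b)`-chain from `x` to `y` leaves `x` with colour `b` and enters `y` with
  -- colour `a`, so it is even; with the edge `xy` it gives the two paths.
  · obtain ⟨x, y, hxy⟩ := hG.exists_adj
    obtain ⟨c, hc⟩ := hG.colorable_delete hxy
    obtain ⟨K, hK⟩ : ∃ K, K = G.deleteEdges {s(x, y)} := ⟨_, rfl⟩
    have hN : ∀ c : Sym2 V → Fin 2, IsProper K c → ∀ a, Misses K c x a → ¬ Misses K c y a :=
      fun c hc a hx => by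
        subst hK
        exact hG.not_misses_both hc hx
    rw [← hK] at hc
    have hKG : K ≤ G := hK ▸ SimpleGraph.deleteEdges_le _
    have hmiss : ∀ v, K.degree v + 1 = G.degree v → ∃ a, Misses K c v a := by
      intro v hv
      have h1 := le_card_misses K c v
      have h2 := hG.degree_le v
      obtain ⟨a, ha⟩ := Finset.card_pos.mp
        (show 0 < (Finset.univ.filter fun a => Misses K c v a).card by omega)
      exact ⟨a, by simpa using ha⟩
    obtain ⟨a, ha⟩ := hmiss x (degree_deleteEdge_add_one hxy hK)
    obtain ⟨b, hb⟩ := hmiss y (degree_deleteEdge_add_one hxy.symm (by rw [hK, Sym2.eq_swap]))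
    obtain ⟨q, hq⟩ := (FanReach.base.reachable hN hc ha hb).symm.exists_isPath
    have hle : kempe K c a b ≤ K := fun _ _ h => h.1
    have hqe : ∀ e ∈ q.edges, e ∈ K.edgeSet ∧ (c e = a ∨ c e = b) := by
      intro e he
      have := q.edges_subset_edgeSet he
      induction e with
      | _ u v => exact this
    have heven : Even q.length := by
      have := (hc.parity (p := q.mapLe hle) (hq.mapLe hle) a b (by simpa using fun e he => (hqe e he).2)
        (by
          intro e he
          rw [SimpleGraph.Walk.edges_mapLe_eq_edges] at he
          cases q with
          | nil => simp at he
          | cons h q =>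
            obtain rfl : _ = e := by simpa using he
            exact ha h.1)).1 hb
      simpa using this
    have hqG : kempe K c a b ≤ G := hle.trans hKG
    refine oddClique_of_paths hxy.ne ![hxy.toWalk, q.mapLe hqG] ?_ ?_ 1 ?_ ?_
    · intro i
      fin_cases i
      · simpa using hxy.ne
      · exact hq.mapLe hqG
    · have hdis : ∀ e ∈ q.edges, e ≠ s(x, y) := by
        rintro e he rfl
        have := (hqe _ he).1
        simp [hK] at this
      intro i k hik
      fin_cases i <;> fin_cases k
      · exact absurd rfl hik
      · intro e he he'
        exact hdis e (by simpa using he') (by simpa using he)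
      · intro e he he'
        exact hdis e (by simpa using he) (by simpa using he')
      · exact absurd rfl hik
    · have h0 : q.length ≠ 0 := fun h => hxy.ne (SimpleGraph.Walk.eq_of_length_eq_zero h)
      obtain ⟨n, hn⟩ := heven
      have : (q.mapLe hqG).length = q.length := by simp
      change 2 ≤ (q.mapLe hqG).length
      omega
    · intro i
      left
      fin_cases i
      · simp
      · simpa using heven
  · obtain ⟨x, a, hxa, hx, ha, hcut⟩ := hG.exists_edge_connected_pair
    obtain ⟨P, hP, hd⟩ := UnitFlow.exists_edgeDisjoint_paths hxa hcut
    have hyinj : ∀ i k, i ≠ k → (P i).getVert 1 ≠ (P k).getVert 1 := fun i k hik heq =>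
      hd i k hik (snd_spec hxa (P i)).2.1 (heq ▸ (snd_spec hxa (P k)).2.1)
    -- At most one of the paths is the single edge `xa`, and at least two paths remain besides `P
    -- i₀`.
    have hother : ∀ i₀, ∃ j, j ≠ i₀ ∧ 2 ≤ (P j).length := by
      intro i₀
      obtain ⟨k₁, h₁, k₂, h₂, hk⟩ := Finset.one_lt_card.mp
        (show 1 < (Finset.univ.erase i₀).card by
          rw [Finset.card_erase_of_mem (Finset.mem_univ _), Finset.card_univ, Fintype.card_fin]
          omega)
      by_cases h : (P k₁).getVert 1 = a
      · exact ⟨k₂, (Finset.mem_erase.mp h₂).1,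
          (snd_spec hxa (P k₂)).2.2 fun h' => hyinj k₁ k₂ hk (h.trans h'.symm)⟩
      · exact ⟨k₁, (Finset.mem_erase.mp h₁).1, (snd_spec hxa (P k₁)).2.2 h⟩
    by_cases hall : ∀ i, 3 ≤ G.degree ((P i).getVert 1)
    · obtain ⟨j, -, hj⟩ := hother ⟨0, by omega⟩
      exact oddClique_of_paths hxa P hP hd j hj fun i => .inr (hall i)
    · push Not at hall
      obtain ⟨i₀, hi₀⟩ := hall
      have hdeg : ∀ i, i ≠ i₀ → 3 ≤ G.degree ((P i).getVert 1) := fun i hi => by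
        rw [hG.degree_eq_of_degree_le_two (snd_spec hxa (P i₀)).1 (snd_spec hxa (P i)).1
          (hyinj i i₀ hi) (by omega)]
        exact hr3
      -- Only `P i₀` may lack a detour. It needs none if it is even and chosen as `P j`, or odd and
      -- not chosen.
      by_cases hev : Even (P i₀).length
      · refine oddClique_of_paths hxa P hP hd i₀ ?_ fun i => ?_
        · have h0 : (P i₀).length ≠ 0 := fun h => hxa (SimpleGraph.Walk.eq_of_length_eq_zero h)
          obtain ⟨n, hn⟩ := hev
          omega
        · by_cases hi : i = i₀
          · subst hi
            exact .inl (iff_of_true hev rfl)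
          · exact .inr (hdeg i hi)
      · obtain ⟨j, hji, hj⟩ := hother i₀
        refine oddClique_of_paths hxa P hP hd j hj fun i => ?_
        by_cases hi : i = i₀
        · subst hi
          exact .inl (iff_of_false hev hji.symm)
        · exact .inr (hdeg i hi)

theorem Colorable.induce_meetGraph {G : SimpleGraph V} {s : ℕ} (h : Colorable G s) :
    ((meetGraph V).induce G.edgeSet).Colorable s := by
  obtain ⟨c, hc⟩ := h
  refine ⟨SimpleGraph.Coloring.mk (fun e => c e) ?_⟩
  rintro ⟨e, he⟩ ⟨f, hf⟩ ⟨hne, v, hve, hvf⟩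
  obtain ⟨u, rfl⟩ := hve
  obtain ⟨w, rfl⟩ := hvf
  refine hc he hf ?_
  rintro rfl
  exact hne rfl

/-- The edges at a vertex form a clique of the line graph. -/
theorem oddClique_star {G : SimpleGraph V} {x : V} {s : ℕ} (y : Fin s → V)
    (hy : Function.Injective y) (hxy : ∀ i, G.Adj x (y i)) :
    OddClique (meetGraph V) G.edgeSet (Fin s) := by
  have hinj : Function.Injective fun i => s(x, y i) := fun i k h => hy (Sym2.congr_right.mp h)
  have hadj : ∀ i k : Fin s, i < k → (meetGraph V).Adj s(x, y i) s(x, y k) := fun i k hik =>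
    ⟨fun h => hik.ne (hinj h), x, by simp, by simp⟩
  refine ⟨fun i => s(x, y i), fun i k hik => (hadj i k hik).toWalk, hinj, hxy,
    fun i k hik => ⟨by simpa using (hadj i k hik).ne, by simp, ?_, ?_⟩,
    fun i k hik i' k' hik' hne e he he' => ?_⟩
  · intro e he
    have : e = s(x, y i) ∨ e = s(x, y k) := by simpa using he
    rcases this with rfl | rfl
    · exact hxy i
    · exact hxy k
  · intro e he _
    simpa using he
  · obtain rfl : e = s(s(x, y i), s(x, y k)) := by simpa using he
    have heq : s(s(x, y i), s(x, y k)) = s(s(x, y i'), s(x, y k')) := by simpa using he'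
    rcases Sym2.eq_iff.mp heq with ⟨h1, h2⟩ | ⟨h1, h2⟩
    · exact hne (Prod.ext (hinj h1) (hinj h2))
    · obtain rfl := hinj h1
      obtain rfl := hinj h2
      exact hik.not_gt hik'

/-- The edges of a simple graph can be coloured with as many colours as the line graph has
terminals of a totally odd strong immersion of a complete graph. -/
theorem exists_colorable_oddClique [Fintype V] (G : SimpleGraph V) :
    ∃ s, ((meetGraph V).induce G.edgeSet).Colorable s ∧
      OddClique ((meetGraph V).induce G.edgeSet) Set.univ (Fin s) := by
  classical
  rcases isEmpty_or_nonempty G.edgeSet with hE | hE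
  · exact ⟨0, SimpleGraph.Colorable.of_isEmpty _, fun i => i.elim0, fun i => i.elim0,
      fun i => i.elim0, fun i => i.elim0, fun i => i.elim0, fun i => i.elim0⟩
  obtain ⟨⟨e, he⟩⟩ := hE
  obtain ⟨u, w, huw⟩ : ∃ u w, G.Adj u w := by
    induction e with
    | _ u w => exact ⟨u, w, he⟩
  have : Nonempty V := ⟨u⟩
  obtain ⟨x, hx⟩ := G.exists_maximal_degree_vertex
  have hdeg : ∀ v, G.degree v ≤ G.degree x := fun v => hx ▸ G.degree_le_maxDegree v
  have hpos : 0 < G.degree x :=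
    ((G.degree_pos_iff_exists_adj u).mpr ⟨w, huw⟩).trans_le (hdeg u)
  by_cases hcol : Colorable G (G.degree x)
  · refine ⟨_, hcol.induce_meetGraph, OddClique.induce ?_⟩
    have f := (Fintype.equivFinOfCardEq (G.card_neighborSet_eq_degree x)).symm
    exact oddClique_star (fun i => (f i : V)) (Subtype.val_injective.comp f.injective)
      fun i => (f i).2
  · refine ⟨_, (colorable_succ hdeg).induce_meetGraph, OddClique.induce ?_⟩
    obtain ⟨K, hK, hcrit⟩ := exists_critical_le hpos hdeg hcol
    have h1 : OddClique (meetGraph V) G.edgeSet (WithTop (Fin (G.degree x))) := by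
      obtain ⟨φ, Q, hφ, hS, hQ, hd⟩ := hcrit.oddClique
      have hsub : K.edgeSet ⊆ G.edgeSet := SimpleGraph.edgeSet_mono hK
      exact ⟨φ, Q, hφ, fun u => hsub (hS u), fun u v h => ⟨(hQ u v h).1, (hQ u v h).2.1,
        fun e he => hsub ((hQ u v h).2.2.1 e he), (hQ u v h).2.2.2⟩, hd⟩
    refine h1.of_card_le ?_
    change _ ≤ Fintype.card (Option (Fin (G.degree x)))
    simp

end EdgeColoring

/-! ### Reduction from multigraphs to simple graphs. -/

section Multigraph

variable {α β : Type*}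

/-- The line graph of a multigraph of constant multiplicity is a blow-up of the line graph of a
finite simple graph. -/
theorem Graph.exists_iso_blowup (H : Graph α β) (hfin : H.edgeSet.Finite) (hloop : H.Loopless)
    (hmult : H.HasConstantMultiplicity) : ∃ (V : Set α) (G : SimpleGraph V) (m : ℕ), V.Finite ∧
      Nonempty (blowup ((meetGraph V).induce G.edgeSet) m ≃g H.lineGraph) := by
  classical
  obtain ⟨m, hm⟩ := hmult
  -- Isolated vertices are dropped because `α` may be infinite.
  set V : Set α := {v | ∃ e, H.Inc e v} with hV
  have hVfin : V.Finite := by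
    have hsub : V ⊆ ⋃ e ∈ H.edgeSet, {v | H.Inc e v} := by
      rintro v ⟨e, he⟩
      exact Set.mem_biUnion he.edge_mem he
    refine (hfin.biUnion fun e he => ?_).subset hsub
    obtain ⟨x, y, hxy⟩ := H.exists_isLink_of_mem_edgeSet he
    exact (Set.toFinite {x, y}).subset fun v hv => hv.eq_or_eq_of_isLink hxy
  let G : SimpleGraph V :=
    { Adj := fun u v => H.Adj u v
      symm := ⟨fun _ _ h => h.symm⟩
      loopless := ⟨fun v h => H.not_adj_self _ h⟩ }
  let fib : Sym2 V → Set β := fun z => {e | ∃ u v : V, z = s(u, v) ∧ H.IsLink e u v}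
  have hfib : ∀ u v : V, fib s(u, v) = {e | H.IsLink e u v} := by
    intro u v
    ext e
    constructor
    · rintro ⟨u', v', heq, h⟩
      rcases Sym2.eq_iff.mp heq with ⟨rfl, rfl⟩ | ⟨rfl, rfl⟩
      · exact h
      · exact h.symm
    · exact fun h => ⟨u, v, rfl, h⟩
  have hcard : ∀ z ∈ G.edgeSet, Nonempty (Fin m ≃ fib z) := by
    intro z hz
    induction z with
    | _ u v =>
      have h1 : (fib s(u, v)).encard = m := by rw [hfib]; exact hm u v hz
      have hf : (fib s(u, v)).Finite := Set.finite_of_encard_eq_coe h1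
      have := hf.fintype
      refine ⟨(Fintype.equivFinOfCardEq ?_).symm⟩
      rw [← Nat.card_eq_fintype_card, Nat.card_coe_set_eq, Set.ncard, h1]
      rfl
  let g : ∀ z ∈ G.edgeSet, Fin m ≃ fib z := fun z hz => (hcard z hz).some
  have ginc : ∀ z hz i (v : V), H.Inc (g z hz i) v ↔ v ∈ z := by
    intro z hz i v
    obtain ⟨u, w, rfl, h⟩ := (g z hz i).2
    rw [Sym2.mem_iff]
    constructor
    · intro hi
      exact (hi.eq_or_eq_of_isLink h).imp Subtype.ext Subtype.ext
    · rintro (rfl | rfl)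
      · exact h.inc_left
      · exact h.inc_right
  have gmem : ∀ z hz i, (g z hz i : β) ∈ H.edgeSet := by
    intro z hz i
    obtain ⟨u, w, -, h⟩ := (g z hz i).2
    exact h.edge_mem
  let f : G.edgeSet × Fin m → H.edgeSet := fun p => ⟨g p.1 p.1.2 p.2, gmem p.1 p.1.2 p.2⟩
  have finj : Function.Injective f := by
    rintro ⟨⟨z, hz⟩, i⟩ ⟨⟨z', hz'⟩, i'⟩ h
    have h1 : (g z hz i : β) = g z' hz' i' := congrArg Subtype.val h
    -- An edge of `H` determines its pair of ends, so different fibres are disjoint.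
    have h2 : z = z' := Sym2.ext fun v => by
      rw [← ginc z hz i, ← ginc z' hz' i', h1]
    subst h2
    rw [(g z hz).injective (Subtype.ext h1)]
  have fsurj : Function.Surjective f := by
    rintro ⟨e, he⟩
    obtain ⟨x, y, hxy⟩ := H.exists_isLink_of_mem_edgeSet he
    let u : V := ⟨x, e, hxy.inc_left⟩
    let v : V := ⟨y, e, hxy.inc_right⟩
    have hz : s(u, v) ∈ G.edgeSet := hxy.adj
    obtain ⟨i, hi⟩ := (g s(u, v) hz).surjective ⟨e, u, v, rfl, hxy⟩
    refine ⟨(⟨s(u, v), hz⟩, i), Subtype.ext ?_⟩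
    change (g s(u, v) hz i : β) = e
    rw [hi]
  refine ⟨V, G, m, hVfin, ⟨⟨Equiv.ofBijective f ⟨finj, fsurj⟩, ?_⟩⟩⟩
  rintro ⟨⟨z, hz⟩, i⟩ ⟨⟨z', hz'⟩, i'⟩
  constructor
  · rintro ⟨hne, x, hx, hx'⟩
    by_cases hzz : z = z'
    · subst hzz
      refine .inr ⟨rfl, ?_⟩
      rintro rfl
      exact hne rfl
    · let v : V := ⟨x, _, hx⟩
      exact .inl ⟨hzz, v, (ginc z hz i v).mp hx, (ginc z' hz' i' v).mp hx'⟩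
  · intro h
    refine ⟨fun heq => (blowup _ m).irrefl (finj heq ▸ h), ?_⟩
    rcases h with ⟨-, v, hv, hv'⟩ | ⟨heq, -⟩
    · exact ⟨v, (ginc z hz i v).mpr hv, (ginc z' hz' i' v).mpr hv'⟩
    · obtain rfl : z = z' := congrArg Subtype.val heq
      induction z with
      | _ u w =>
        exact ⟨u, (ginc _ hz i u).mpr (by simp), (ginc _ hz' i' u).mpr (by simp)⟩

end Multigraph

theorem theorem1p2 {α β : Type*} (H : Graph α β) (hfin : H.edgeSet.Finite)
    (hloop : H.Loopless) (hmult : H.HasConstantMultiplicity) :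
    ∃ t : ℕ, H.lineGraph.chromaticNumber = t ∧
      ∃ I : GraphImmersion (⊤ : SimpleGraph (Fin t)) H.lineGraph, I.IsStrong ∧ I.IsTotallyOdd := by
  classical
  obtain ⟨V, G, m, hV, ⟨iso⟩⟩ := H.exists_iso_blowup hfin hloop hmult
  have := hV.fintype
  obtain ⟨s, hcol, himm⟩ := EdgeColoring.exists_colorable_oddClique G
  have hcolH : H.lineGraph.Colorable (s * m) :=
    (blowup_colorable hcol m).of_hom iso.symm.toHom
  have hle : H.lineGraph.chromaticNumber ≤ (s * m : ℕ) := hcolH.chromaticNumber_le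
  obtain ⟨t, ht⟩ := ENat.ne_top_iff_exists.mp (ne_top_of_le_ne_top (ENat.natCast_ne_top _) hle)
  refine ⟨t, ht.symm, ?_⟩
  have htle : t ≤ s * m := by
    rw [← ht] at hle
    exact_mod_cast hle
  -- The number `s * m` counts the terminals and also bounds the chromatic number, so `t` of the
  -- terminals suffice.
  have h1 := (himm.blowup m).map iso.toHom iso.injective
  refine (h1.of_card_le ?_).exists_graphImmersion
  change t ≤ Fintype.card (Fin s × Fin m)
  simpa using htle
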